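/- **Corollary (plug-in estimator).** Let $Z, Z_1, Z_2, \dots$ be i.i.d. with law $P$, let $\ell(z,\theta)$ be a real-valued sample function with $\theta\in\mathbb{R}^p$, and let $L(\theta)=\mathbf{E}[\ell(Z,\theta)]$ with minimizer $\theta_\star$. Gradients $\nabla$ and Hessians $\nabla^2$ are taken in $\theta$; $\|\cdot\|$ is the Euclidean norm of vectors and the operator 2-norm of matrices. Let $\gamma_n=\gamma_1 n^{-\gamma}$ with $\gamma_1>0$ and $\gamma\in(1/2,1)$, let $\theta_0\in\mathbb{R}^p$ be deterministic, and for $n\ge 1$ let $$\theta_n=\operatorname*{argmin}_{\theta'\in\mathbb{R}^p}\Big\{\ell(Z_n,\theta')+\tfrac{1}{2\gamma_n}\|\theta'-\theta_{n-1}\|^2\Big\}.$$ Let $\mathcal{F}_n$ be the $\sigma$-algebra generated by $Z_1,\dots,Z_n$. Assume: 1. $\ell(z,\cdot)$ is convex on $\mathbb{R}^p$ for every $z$, and $\ell(Z,\theta)$ is integrable for every $\theta$. 2. Almost surely $\ell(Z,\cdot)$ is continuously differentiable and $\|\nabla\ell(Z,\theta)-\nabla\ell(Z,\theta_\star)\|\le\beta(Z)\|\theta-\theta_\star\|$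 for all $\theta$, where $\mathbf{E}[\beta^2(Z)]<\infty$. 3. There are random symmetric matrices $\Lambda(Z)\succeq 0$ with $\mathbf{E}[\Lambda(Z)]$ (finite and) positive definite such that, almost surely, $\ell(Z,\theta)\ge\ell(Z,\theta_\star)+s^T(\theta-\theta_\star)+\frac12(\theta-\theta_\star)^T\Lambda(Z)(\theta-\theta_\star)$ for all $\theta$ and all subgradients $s$ of $\ell(Z,\cdot)$ at $\theta_\star$. 4. $\mathbf{E}\|\nabla\ell(Z,\theta_\star)\|^2\le\sigma^2<\infty$. 5. $L$ is twice differentiable at $\theta_\star$; write $\mathcal{H}(\theta_\star)=\nabla^2L(\theta_\star)$. 6. For $\varepsilon_n=\nabla L(\theta_{n-1})-\nabla\ell(Z_n,\theta_{n-1})$ there are constants $\Sigma_3,\Sigma_4$ with $\mathbf{E}[\|\varepsilon_n\|^4\mid\mathcal{F}_{n-1}]\le\Sigma_3+\Sigma_4\|\theta_{n-1}-\theta_\star\|^4$ almost surely for all $n\ge1$, where each $\|\varepsilon_n\|^4$ is integrable. 7. Almost surely $\ell(Z,\cdot)$ is twice differentiable and $\|\nabla^2\ell(Z,\theta)-\nabla^2\ell(Z,\theta_\star)\|\le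 M\|\theta-\theta_\star\|$ for all $\theta$, with a constant $M$. 8. $\|\mathbf{E}[(\nabla^2\ell(Z,\theta_\star))^2]-\mathcal{H}(\theta_\star)^2\|\le L_4$ for a constant $L_4$ (the expectation being finite). Put $\mathcal{I}(\theta_\star)=\mathbf{E}[\nabla\ell(Z,\theta_\star)\nabla\ell(Z,\theta_\star)^T]$ and $$\hat H_n=\frac1n\sum_{k=1}^n\nabla^2\ell(Z_k,\theta_{k-1}),\qquad \hat I_n=\frac1n\sum_{k=1}^n\nabla\ell(Z_k,\theta_{k-1})\nabla\ell(Z_k,\theta_{k-1})^T .$$ Fix $\delta\in(0,\lambda_{\min}(\mathcal{H}(\theta_\star)))$, where $\lambda_{\min}$ is the smallest eigenvalue, and let $\tilde H_n=Q\,\mathrm{diag}(\max(d_1,\delta),\dots,\max(d_p,\delta))\,Q^T$ for the spectral decomposition $\hat H_n=Q\,\mathrm{diag}(d_1,\dots,d_p)\,Q^T$. Then $$\mathbf{E}\big\|\tilde H_n^{-1}\hat I_n\tilde H_n^{-1}-\mathcal{H}(\theta_\star)^{-1}\mathcal{I}(\theta_\star)\mathcal{H}(\theta_\star)^{-1}\big\|=O(\gamma_n^{1/2}),$$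 that is, there is a constant $c>0$ such that for every $n\ge1$ the left-hand side is finite and at most $c\,\gamma_n^{1/2}$. -/

import Mathlib

open MeasureTheory ProbabilityTheory Filter Topology
open scoped Matrix Matrix.Norms.L2Operator

noncomputable section

namespace ProxRM

/-- Matrices of size `p × p` carry the operator norm induced by the Euclidean norm
(`Matrix.Norms.L2Operator`); parameters live in `ℝ^p` with the Euclidean norm. -/
abbrev Param (p : ℕ) := EuclideanSpace ℝ (Fin p)

/-- The proximity operator `prox_{c f}(x) = argmin_y { f y + ‖y - x‖² / (2 c) }`
(for `c > 0` and `f` real-valued convex, the minimizer exists and is unique). -/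
def prox {p : ℕ} (c : ℝ) (f : Param p → ℝ) (x : Param p) : Param p :=
  Classical.epsilon fun y : Param p =>
    IsMinOn (fun y' : Param p => f y' + 1 / (2 * c) * ‖y' - x‖ ^ 2) Set.univ y

/-- The learning rate `γ_n = γ₁ n^{-γ}`. -/
def stepSize (γ₁ γ : ℝ) (n : ℕ) : ℝ := γ₁ * (n : ℝ) ^ (-γ)

/-- The proximal Robbins-Monro (implicit SGD) iterates
`θ_n = prox_{γ_n ℓ(Z_n, ·)}(θ_{n-1})`, `n ≥ 1`, for a given data sequence `Z_1, Z_2, …`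
(the entry `z 0` is never used). -/
def iterate {S : Type*} {p : ℕ} (ℓ : S → Param p → ℝ) (step : ℕ → ℝ) (θ₀ : Param p)
    (z : ℕ → S) : ℕ → Param p
  | 0 => θ₀
  | n + 1 => prox (step (n + 1)) (ℓ (z (n + 1))) (iterate ℓ step θ₀ z n)

/-- The objective `L(θ) = E[ℓ(Z, θ)]`. -/
def objective {S : Type*} [MeasurableSpace S] {p : ℕ} (P : Measure S) (ℓ : S → Param p → ℝ)
    (θ : Param p) : ℝ :=
  ∫ z, ℓ z θ ∂P

/-- `f` is twice differentiable at `x`: it is differentiable near `x` and its gradient is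
differentiable at `x`. -/
def TwiceDifferentiableAt {p : ℕ} (f : Param p → ℝ) (x : Param p) : Prop :=
  (∀ᶠ y in 𝓝 x, DifferentiableAt ℝ f y) ∧ DifferentiableAt ℝ (gradient f) x

/-- The Hessian matrix of `f` at `x`: the matrix, in the standard basis, of the derivative
of the gradient. -/
def hessian {p : ℕ} (f : Param p → ℝ) (x : Param p) : Matrix (Fin p) (Fin p) ℝ :=
  (Matrix.toEuclideanCLM (n := Fin p) (𝕜 := ℝ)).symm (fderiv ℝ (gradient f) x)

/-- The outer product `v vᵀ`. -/
def outer {p : ℕ} (v : Param p) : Matrix (Fin p) (Fin p) ℝ :=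
  Matrix.of fun i j => v i * v j

/-- Integrability of a random matrix (entry by entry). -/
def IntegrableMat {S : Type*} [MeasurableSpace S] {p : ℕ} (P : Measure S)
    (A : S → Matrix (Fin p) (Fin p) ℝ) : Prop :=
  ∀ i j, Integrable (fun z => A z i j) P

/-- The expectation of a random matrix (entry by entry). -/
def expectMat {S : Type*} [MeasurableSpace S] {p : ℕ} (P : Measure S)
    (A : S → Matrix (Fin p) (Fin p) ℝ) : Matrix (Fin p) (Fin p) ℝ :=
  Matrix.of fun i j => ∫ z, A z i j ∂P

/-- The smallest eigenvalue of a symmetric matrix. -/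
def lambdaMin {p : ℕ} (A : Matrix (Fin p) (Fin p) ℝ) : ℝ := sInf (spectrum ℝ A)

/-- The subdifferential of `f` at `x`. -/
def subdifferential {p : ℕ} (f : Param p → ℝ) (x : Param p) : Set (Param p) :=
  {s | ∀ y, f x + inner ℝ s (y - x) ≤ f y}

/-- `M`-convexity of `f` at `x`:
`f y ≥ f x + sᵀ(y - x) + ½ (y - x)ᵀ M (y - x)` for all `y` and all `s ∈ ∂f(x)`. -/
def MConvexAt {p : ℕ} (M : Matrix (Fin p) (Fin p) ℝ) (f : Param p → ℝ) (x : Param p) : Prop :=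
  ∀ s ∈ subdifferential f x, ∀ y,
    f x + inner ℝ s (y - x) + 1 / 2 * ((y - x).ofLp ⬝ᵥ M *ᵥ (y - x).ofLp) ≤ f y

section Assumptions

variable {S : Type*} [MeasurableSpace S] {p : ℕ}

/-- The sample function is convex in the parameter and integrable in the datum. -/
def ConvexIntegrable (P : Measure S) (ℓ : S → Param p → ℝ) : Prop :=
  (∀ z, ConvexOn ℝ Set.univ (ℓ z)) ∧
    ∀ θ, Measurable (fun z => ℓ z θ) ∧ Integrable (fun z => ℓ z θ) P

/-- Almost surely `ℓ(Z, ·)` is continuously differentiable with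
`‖∇ℓ(Z, θ) - ∇ℓ(Z, θ⋆)‖ ≤ β(Z) ‖θ - θ⋆‖` for all `θ`, where `E[β(Z)²] < ∞`. -/
def SmoothAround (P : Measure S) (ℓ : S → Param p → ℝ) (θs : Param p) (β : S → ℝ) : Prop :=
  MemLp β 2 P ∧
    ∀ᵐ z ∂P, ContDiff ℝ 1 (ℓ z) ∧
      ∀ θ, ‖gradient (ℓ z) θ - gradient (ℓ z) θs‖ ≤ β z * ‖θ - θs‖

/-- Almost surely `Λ(Z) ⪰ 0` and `ℓ(Z, ·)` is `Λ(Z)`-convex at `θ⋆`, and `E[Λ(Z)]` is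
positive definite. -/
def StronglyConvexInMean (P : Measure S) (ℓ : S → Param p → ℝ) (θs : Param p)
    (Λ : S → Matrix (Fin p) (Fin p) ℝ) : Prop :=
  (∀ᵐ z ∂P, (Λ z).PosSemidef ∧ MConvexAt (Λ z) (ℓ z) θs) ∧
    IntegrableMat P Λ ∧ (expectMat P Λ).PosDef

/-- `E‖∇ℓ(Z, θ⋆)‖² ≤ σ² < ∞`. -/
def NoiseLevel (P : Measure S) (ℓ : S → Param p → ℝ) (θs : Param p) (σ : ℝ) : Prop :=
  Integrable (fun z => ‖gradient (ℓ z) θs‖ ^ 2) P ∧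
    ∫ z, ‖gradient (ℓ z) θs‖ ^ 2 ∂P ≤ σ ^ 2

/-- Almost surely `ℓ(Z, ·)` is twice differentiable and
`‖∇²ℓ(Z, θ) - ∇²ℓ(Z, θ⋆)‖ ≤ M ‖θ - θ⋆‖` for all `θ`. -/
def HessianLipschitzAt (P : Measure S) (ℓ : S → Param p → ℝ) (θs : Param p) (M : ℝ) : Prop :=
  ∀ᵐ z ∂P, ∀ θ, TwiceDifferentiableAt (ℓ z) θ ∧
    ‖hessian (ℓ z) θ - hessian (ℓ z) θs‖ ≤ M * ‖θ - θs‖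

/-- `‖E[(∇²ℓ(Z, θ⋆))²] - (∇²L(θ⋆))²‖ ≤ L₄`. -/
def HessianSecondMoment (P : Measure S) (ℓ : S → Param p → ℝ) (θs : Param p) (L₄ : ℝ) : Prop :=
  IntegrableMat P (fun z => hessian (ℓ z) θs ^ 2) ∧
    ‖expectMat P (fun z => hessian (ℓ z) θs ^ 2) - hessian (objective P ℓ) θs ^ 2‖ ≤ L₄

/-- The σ-algebra `ℱ_n` generated by `Z_1, …, Z_n`. -/
abbrev pastSigma {Ω : Type*} (Z : ℕ → Ω → S) (n : ℕ) : MeasurableSpace Ω :=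
  ⨆ k ∈ Finset.Icc 1 n, MeasurableSpace.comap (Z k) inferInstance

/-- With `ε_n = ∇L(θ_{n-1}) - ∇ℓ(Z_n, θ_{n-1})`, the bound
`E[‖ε_n‖⁴ | ℱ_{n-1}] ≤ Σ₃ + Σ₄ ‖θ_{n-1} - θ⋆‖⁴` almost surely, for all `n ≥ 1`.
Integrability of `‖ε_n‖⁴` is part of the condition, since `condExp` of a non-integrable
function is `0` by convention. -/
def FourthMomentBound {Ω : Type*} [MeasurableSpace Ω] (μ : Measure Ω) (P : Measure S)
    (ℓ : S → Param p → ℝ) (Z : ℕ → Ω → S) (θ : ℕ → Ω → Param p) (θs : Param p)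
    (Sig₃ Sig₄ : ℝ) : Prop :=
  ∀ n : ℕ, 1 ≤ n →
    Integrable (fun ω => ‖gradient (objective P ℓ) (θ (n - 1) ω) -
      gradient (ℓ (Z n ω)) (θ (n - 1) ω)‖ ^ 4) μ ∧
    ∀ᵐ ω ∂μ,
      (μ[fun ω' => ‖gradient (objective P ℓ) (θ (n - 1) ω') -
        gradient (ℓ (Z n ω')) (θ (n - 1) ω')‖ ^ 4 | pastSigma Z (n - 1)]) ω ≤
        Sig₃ + Sig₄ * ‖θ (n - 1) ω - θs‖ ^ 4

end Assumptions

section Estimators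

variable {S : Type*} {p : ℕ}

/-- `Ĥ_n = (1/n) ∑_{k=1}^n ∇²ℓ(Z_k, θ_{k-1})`. -/
def hessianAverage (ℓ : S → Param p → ℝ) (z : ℕ → S) (θ : ℕ → Param p) (n : ℕ) :
    Matrix (Fin p) (Fin p) ℝ :=
  (1 / (n : ℝ)) • ∑ k ∈ Finset.Icc 1 n, hessian (ℓ (z k)) (θ (k - 1))

/-- `Î_n = (1/n) ∑_{k=1}^n ∇ℓ(Z_k, θ_{k-1}) ∇ℓ(Z_k, θ_{k-1})ᵀ`. -/
def gradientCovAverage (ℓ : S → Param p → ℝ) (z : ℕ → S) (θ : ℕ → Param p) (n : ℕ) :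
    Matrix (Fin p) (Fin p) ℝ :=
  (1 / (n : ℝ)) • ∑ k ∈ Finset.Icc 1 n, outer (gradient (ℓ (z k)) (θ (k - 1)))

open Classical in
/-- For a symmetric matrix `A = U diag(d_1, …, d_p) Uᵀ` with `U` orthogonal, the matrix
`U diag(max(d_1, δ), …, max(d_p, δ)) Uᵀ` (which does not depend on the choice of `U`).
The value for a matrix that is not symmetric is irrelevant. -/
def eigenvalueFloor (δ : ℝ) (A : Matrix (Fin p) (Fin p) ℝ) : Matrix (Fin p) (Fin p) ℝ :=
  if h : A.IsHermitian then
    (h.eigenvectorUnitary : Matrix (Fin p) (Fin p) ℝ) *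
      Matrix.diagonal (fun i => max (h.eigenvalues i) δ) *
      (h.eigenvectorUnitary : Matrix (Fin p) (Fin p) ℝ)ᵀ
  else 0

/-- The eigenvalue floor is the function `x ↦ max x δ` applied to `A` in the functional
calculus; in particular it does not depend on the choice of the eigenvectors. -/
theorem eigenvalueFloor_eq_cfc (δ : ℝ) (A : Matrix (Fin p) (Fin p) ℝ) :
    eigenvalueFloor δ A = cfc (fun x : ℝ => max x δ) A := by
  unfold eigenvalueFloor
  split_ifs with h
  · rw [Matrix.IsHermitian.cfc_eq h, Matrix.IsHermitian.cfc]
    rfl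
  · exact (cfc_apply_of_not_predicate A h).symm

end Estimators

end ProxRM

end

open ProxRM

/-! The claim reduces to two mean estimates, E‖Ĥ_n - H‖ = O(γ_n^{1/2}) and E‖Î_n - I‖ =
O(γ_n^{1/2}). Flooring bounds the inverse of H̃_n by δ⁻¹. It moves Ĥ_n by at most ‖Ĥ_n - H‖, since H
has spectrum above δ and so Ĥ_n has spectrum above δ - ‖Ĥ_n - H‖. Hence the sandwich error is
bounded pointwise by a linear combination of ‖Î_n - I‖ and ‖Ĥ_n - H‖ (`norm_sandwich_sub_le`), and
first moments suffice.

Each estimator is an i.i.d. average at the minimizer plus the effect of evaluating the k-th term at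
θ_{k-1}. The i.i.d. part has mean error of order n^{-1/2}, which γ_n^{1/2} dominates. The
perturbations have mean O(γ_k^{1/2}), and averaging them over k ≤ n loses only a factor 2
(`exists_integral_abs_average_sub_le`).

The perturbation bound rests on E‖θ_n - θs‖² = O(γ_{n+1}) (`exists_sq_dist_iterate_le`). The
proximal inequality and Λ(Z)-convexity yield a one-step contraction (`sq_norm_prox_sub_le`). The
curvature is damped to absorb large values of Λ(Z), yet remains positive definite in mean.
Independence of the new sample from the past removes the linear noise term, and Chung's lemma solves
the recursion.

The i.i.d. part of Î_n also needs a finite fourth moment of ∇ℓ(Z, θs), whereas the noise hypothesis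
concerns the iterates. As these approach θs in mean square, they supply points tending to θs at
which the centred gradient has a uniformly bounded fourth moment, and Fatou's lemma passes to the
limit (`integrable_norm_gradient_pow_four`). -/

namespace ProxRM

/-! ### Existence, characterization and measurability of the proximity operator -/

section Prox

variable {p : ℕ}

lemma continuous_of_convexOn {f : Param p → ℝ} (hf : ConvexOn ℝ Set.univ f) : Continuous f :=
  hf.locallyLipschitz.continuous

/-- By convexity along rays, a lower bound on the unit ball around `x` lets `f` decrease at most
linearly outside it. The quadratic term wins outside a large ball, so a minimizer over that compact
ball is global. -/
lemma exists_forall_add_sq_le {f : Param p → ℝ} (hf : ConvexOn ℝ Set.univ f) {a : ℝ} (ha : 0 < a)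
    (x : Param p) : ∃ y, ∀ w, f y + a * ‖y - x‖ ^ 2 ≤ f w + a * ‖w - x‖ ^ 2 := by
  have hcont := continuous_of_convexOn hf
  obtain ⟨m, hm⟩ : ∃ m, ∀ y ∈ Metric.closedBall x 1, m ≤ f y := by
    obtain ⟨y, -, hy⟩ := (isCompact_closedBall x 1).exists_isMinOn
      ⟨x, by simp⟩ hcont.continuousOn
    exact ⟨f y, fun z hz => hy hz⟩
  have hmx : m ≤ f x := hm x (by simp)
  have hlow : ∀ y, 1 ≤ ‖y - x‖ → f x - (f x - m) * ‖y - x‖ ≤ f y := by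
    intro y hy
    set r := ‖y - x‖ with hr
    have hr0 : 0 < r := by linarith
    have h1 : m ≤ f ((1 - r⁻¹) • x + r⁻¹ • y) := by
      apply hm
      rw [mem_closedBall_iff_norm]
      have : (1 - r⁻¹) • x + r⁻¹ • y - x = r⁻¹ • (y - x) := by module
      rw [this, norm_smul, Real.norm_of_nonneg (by positivity), ← hr, inv_mul_cancel₀ hr0.ne']
    have h2 := hf.2 (Set.mem_univ x) (Set.mem_univ y)
      (sub_nonneg.2 (inv_le_one_of_one_le₀ hy)) (by positivity : 0 ≤ r⁻¹) (by ring)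
    have h3 : m ≤ (1 - r⁻¹) * f x + r⁻¹ * f y := h1.trans h2
    have h4 := mul_le_mul_of_nonneg_left h3 hr0.le
    have h5 : r * ((1 - r⁻¹) * f x + r⁻¹ * f y) = (r - 1) * f x + f y := by
      field_simp
    rw [h5] at h4
    linarith
  set R := max 1 ((f x - m) / a) with hR
  obtain ⟨y, -, hy⟩ := (isCompact_closedBall x R).exists_isMinOn
    ⟨x, by simp [hR]⟩
    (f := fun y => f y + a * ‖y - x‖ ^ 2) (by fun_prop)
  refine ⟨y, fun w => ?_⟩
  by_cases hw : w ∈ Metric.closedBall x R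
  · exact hy hw
  · have hw' : R < ‖w - x‖ := by simpa [dist_eq_norm] using hw
    have h1 : 1 ≤ ‖w - x‖ := (le_max_left _ _).trans hw'.le
    have h2 : (f x - m) / a ≤ ‖w - x‖ := (le_max_right _ _).trans hw'.le
    have h3 := hlow w h1
    have h4 : f y + a * ‖y - x‖ ^ 2 ≤ f x + a * ‖x - x‖ ^ 2 :=
      hy (show x ∈ Metric.closedBall x R by simp [hR])
    rw [div_le_iff₀ ha] at h2
    simp only [sub_self, norm_zero] at h4
    nlinarith [norm_nonneg (w - x)]

/-- The penalized function is strongly convex, so its minimum has a quadratic gap: compare `y` with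
the point a fraction `t` of the way to `w`, divide by `t` and let `t` tend to 0. The gap drives both
the contraction estimate and the convergence of approximate minimizers. -/
lemma add_sq_le_of_forall {f : Param p → ℝ} (hf : ConvexOn ℝ Set.univ f) {a : ℝ}
    {x y : Param p} (hy : ∀ w, f y + a * ‖y - x‖ ^ 2 ≤ f w + a * ‖w - x‖ ^ 2) (w : Param p) :
    f y + a * ‖y - x‖ ^ 2 + a * ‖w - y‖ ^ 2 ≤ f w + a * ‖w - x‖ ^ 2 := by
  have key : ∀ t ∈ Set.Ioo (0 : ℝ) 1,
      f y + a * ‖y - x‖ ^ 2 + a * (1 - t) * ‖w - y‖ ^ 2 ≤ f w + a * ‖w - x‖ ^ 2 := by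
    intro t ht
    have h1 := hy ((1 - t) • y + t • w)
    have h2 := hf.2 (Set.mem_univ y) (Set.mem_univ w) (sub_nonneg.2 ht.2.le) ht.1.le (by ring)
    have h3 : ‖(1 - t) • y + t • w - x‖ ^ 2
        = (1 - t) * ‖y - x‖ ^ 2 + t * ‖w - x‖ ^ 2 - t * (1 - t) * ‖w - y‖ ^ 2 := by
      have e1 : (1 - t) • y + t • w - x = (y - x) + t • (w - y) := by module
      have e2 : w - x = (y - x) + (w - y) := by abel
      rw [e1, e2, norm_add_sq_real, norm_add_sq_real, inner_smul_right, norm_smul,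
        Real.norm_of_nonneg ht.1.le]
      ring
    rw [h3] at h1
    simp only [smul_eq_mul] at h2
    have h4 : t * (f y + a * ‖y - x‖ ^ 2 + a * (1 - t) * ‖w - y‖ ^ 2)
        ≤ t * (f w + a * ‖w - x‖ ^ 2) := by nlinarith
    exact le_of_mul_le_mul_left h4 ht.1
  have hlim : Tendsto (fun t : ℝ => f y + a * ‖y - x‖ ^ 2 + a * (1 - t) * ‖w - y‖ ^ 2)
      (𝓝[>] 0) (𝓝 (f y + a * ‖y - x‖ ^ 2 + a * (1 - 0) * ‖w - y‖ ^ 2)) :=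
    ((by fun_prop : Continuous fun t : ℝ =>
      f y + a * ‖y - x‖ ^ 2 + a * (1 - t) * ‖w - y‖ ^ 2).tendsto 0).mono_left nhdsWithin_le_nhds
  have := le_of_tendsto hlim
    (mem_of_superset (Ioo_mem_nhdsGT (show (0 : ℝ) < 1 by norm_num)) key)
  simpa using this

lemma prox_spec {f : Param p → ℝ} (hf : ConvexOn ℝ Set.univ f) {c : ℝ} (hc : 0 < c)
    (x w : Param p) :
    f (prox c f x) + 1 / (2 * c) * ‖prox c f x - x‖ ^ 2 + 1 / (2 * c) * ‖w - prox c f x‖ ^ 2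
      ≤ f w + 1 / (2 * c) * ‖w - x‖ ^ 2 := by
  have ha : 0 < 1 / (2 * c) := by positivity
  refine add_sq_le_of_forall hf ?_ w
  have h : ∃ y : Param p,
      IsMinOn (fun y' : Param p => f y' + 1 / (2 * c) * ‖y' - x‖ ^ 2) Set.univ y := by
    obtain ⟨y, hy⟩ := exists_forall_add_sq_le hf ha x
    exact ⟨y, fun w _ => hy w⟩
  exact fun w => Classical.epsilon_spec h (Set.mem_univ w)

/-- The proximity operator depends measurably on the data and the point. -/
lemma measurable_prox {S : Type*} [MeasurableSpace S] {ℓ : S → Param p → ℝ}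
    (hconv : ∀ z, ConvexOn ℝ Set.univ (ℓ z)) (hmeas : ∀ θ, Measurable fun z => ℓ z θ)
    {c : ℝ} (hc : 0 < c) : Measurable fun q : S × Param p => prox c (ℓ q.1) q.2 := by
  classical
  set a := 1 / (2 * c) with ha_def
  have ha : 0 < a := by positivity
  let d : ℕ → Param p := TopologicalSpace.denseSeq (Param p)
  have hd : DenseRange d := TopologicalSpace.denseRange_denseSeq _
  let F : Param p → S × Param p → ℝ := fun w q => ℓ q.1 w + a * ‖w - q.2‖ ^ 2
  have hF : ∀ w, Measurable (F w) := fun w =>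
    ((hmeas w).comp measurable_fst).add
      (((measurable_const.sub measurable_snd).norm.pow_const 2).const_mul a)
  have hFc : ∀ q, Continuous fun w => F w q := fun q =>
    (continuous_of_convexOn (hconv q.1)).add (by fun_prop)
  have hspec : ∀ q w, F (prox c (ℓ q.1) q.2) q + a * ‖w - prox c (ℓ q.1) q.2‖ ^ 2 ≤ F w q :=
    fun q w => prox_spec (hconv q.1) hc q.2 w
  have hex : ∀ (k : ℕ) (q : S × Param p), ∃ i, ∀ j, F (d i) q ≤ F (d j) q + 1 / ((k : ℝ) + 1) := by
    intro k q
    have hk : (0 : ℝ) < 1 / ((k : ℝ) + 1) := by positivity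
    obtain ⟨i, hi⟩ := hd.exists_mem_open
      (isOpen_lt (hFc q) (continuous_const (y := F (prox c (ℓ q.1) q.2) q + 1 / ((k : ℝ) + 1))))
      ⟨prox c (ℓ q.1) q.2, by simpa using by positivity⟩
    refine ⟨i, fun j => ?_⟩
    have h1 := hspec q (d j)
    have h2 : F (d i) q < F (prox c (ℓ q.1) q.2) q + 1 / ((k : ℝ) + 1) := hi
    have h3 : 0 ≤ a * ‖d j - prox c (ℓ q.1) q.2‖ ^ 2 := by positivity
    linarith
  -- The k-th approximation is the first point of the dense sequence minimizing up to 1/(k+1).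
  -- Selecting a first index is measurable, and the quadratic gap forces these points to converge to
  -- the minimizer.
  refine measurable_of_tendsto_metrizable (f := fun k q => d (Nat.find (hex k q))) ?_ ?_
  · intro k
    refine (measurable_from_nat (f := d)).comp (measurable_find (hex k) fun i => ?_)
    simp only [Set.ofPred_forall]
    exact MeasurableSet.iInter fun j => measurableSet_le (hF _) ((hF _).add_const _)
  · rw [tendsto_pi_nhds]
    intro q
    rw [tendsto_iff_norm_sub_tendsto_zero]
    have hbound : ∀ k : ℕ, ‖d (Nat.find (hex k q)) - prox c (ℓ q.1) q.2‖
        ≤ Real.sqrt (1 / ((k : ℝ) + 1) / a) := by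
      intro k
      refine Real.le_sqrt_of_sq_le ?_
      rw [le_div_iff₀ ha]
      have h1 := hspec q (d (Nat.find (hex k q)))
      have h2 : F (d (Nat.find (hex k q))) q
          ≤ F (prox c (ℓ q.1) q.2) q + 1 / ((k : ℝ) + 1) := by
        have hcl : IsClosed {w | F (d (Nat.find (hex k q))) q ≤ F w q + 1 / ((k : ℝ) + 1)} :=
          isClosed_le continuous_const ((hFc q).add continuous_const)
        have hsub : Set.range d ⊆ {w | F (d (Nat.find (hex k q))) q
            ≤ F w q + 1 / ((k : ℝ) + 1)} := by
          rintro _ ⟨j, rfl⟩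
          exact Nat.find_spec (hex k q) j
        exact hcl.closure_subset_iff.2 hsub (hd _)
      linarith
    refine squeeze_zero (fun _ => norm_nonneg _) hbound ?_
    have h0 : Tendsto (fun k : ℕ => 1 / ((k : ℝ) + 1) / a) atTop (𝓝 0) := by
      simpa using (tendsto_one_div_add_atTop_nhds_zero_nat (𝕜 := ℝ)).div_const a
    have h1 := (Real.continuous_sqrt.tendsto 0).comp h0
    rwa [Real.sqrt_zero] at h1

end Prox

/-! ### Adaptedness of the iterates and independence from the next sample -/

section Iterates

variable {p : ℕ} {S : Type*} [MeasurableSpace S] {Ω : Type*}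

lemma pastSigma_mono (Z : ℕ → Ω → S) {m n : ℕ} (h : m ≤ n) : pastSigma Z m ≤ pastSigma Z n :=
  biSup_mono fun _ hk => Finset.Icc_subset_Icc_right h hk

lemma measurable_pastSigma (Z : ℕ → Ω → S) {k n : ℕ} (hk : 1 ≤ k) (hkn : k ≤ n) :
    Measurable[pastSigma Z n] (Z k) := by
  rw [measurable_iff_comap_le]
  exact le_biSup (fun k => MeasurableSpace.comap (Z k) inferInstance)
    (Finset.mem_Icc.2 ⟨hk, hkn⟩)

lemma measurable_iterate {ℓ : S → Param p → ℝ}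
    (hconv : ∀ z, ConvexOn ℝ Set.univ (ℓ z)) (hmeas : ∀ θ, Measurable fun z => ℓ z θ)
    {step : ℕ → ℝ} (hstep : ∀ n, 1 ≤ n → 0 < step n) (θ₀ : Param p) (Z : ℕ → Ω → S) (n : ℕ) :
    Measurable[pastSigma Z n] fun ω => iterate ℓ step θ₀ (fun k => Z k ω) n := by
  induction n with
  | zero => exact measurable_const
  | succ n ih =>
    exact (measurable_prox hconv hmeas (hstep (n + 1) (by omega))).comp
      ((measurable_pastSigma Z (by omega) le_rfl).prodMk
        (ih.mono (pastSigma_mono Z (Nat.le_succ n)) le_rfl))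

lemma pastSigma_le [MeasurableSpace Ω] {Z : ℕ → Ω → S} (hZ : ∀ k, 1 ≤ k → Measurable (Z k))
    (n : ℕ) : pastSigma Z n ≤ ‹MeasurableSpace Ω› :=
  iSup₂_le fun k hk => (hZ k (Finset.mem_Icc.1 hk).1).comap_le

lemma indep_pastSigma [MeasurableSpace Ω] {μ : Measure Ω} {Z : ℕ → Ω → S}
    (hZ : ∀ k, 1 ≤ k → Measurable (Z k))
    (hind : iIndepFun (fun k : ℕ => Z (k + 1)) μ) (n : ℕ) :
    Indep (pastSigma Z n) (MeasurableSpace.comap (Z (n + 1)) inferInstance) μ := by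
  -- The independent family is shifted by one: Z_1, …, Z_n have indices below `n`, and the next
  -- sample has index `n`.
  have h := indep_iSup_of_disjoint
    (m := fun k : ℕ => MeasurableSpace.comap (Z (k + 1)) inferInstance)
    (fun k => (hZ (k + 1) (by omega)).comap_le) hind
    (S := Set.Iio n) (T := {n}) (by simp)
  refine indep_of_indep_of_le_left (indep_of_indep_of_le_right h ?_) ?_
  · exact le_biSup (fun k => MeasurableSpace.comap (Z (k + 1)) inferInstance) rfl
  · refine iSup₂_le fun k hk => ?_
    obtain ⟨hk1, hk2⟩ := Finset.mem_Icc.1 hk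
    obtain ⟨k, rfl⟩ : ∃ j, k = j + 1 := ⟨k - 1, by omega⟩
    exact le_biSup (fun k => MeasurableSpace.comap (Z (k + 1)) inferInstance)
      (show k ∈ Set.Iio n from hk2)

lemma map_prodMk_eq_prod [MeasurableSpace Ω] {μ : Measure Ω} [IsProbabilityMeasure μ]
    {Z : ℕ → Ω → S} (hZ : ∀ k, 1 ≤ k → Measurable (Z k))
    (hind : iIndepFun (fun k : ℕ => Z (k + 1)) μ) (n : ℕ) {E : Type*} [MeasurableSpace E]
    {X : Ω → E} (hX : Measurable[pastSigma Z n] X) :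
    μ.map (fun ω => (Z (n + 1) ω, X ω)) = (μ.map (Z (n + 1))).prod (μ.map X) := by
  have h1 : IndepFun (Z (n + 1)) X μ := by
    rw [IndepFun_iff_Indep]
    exact (indep_of_indep_of_le_left (indep_pastSigma hZ hind n) hX.comap_le).symm
  exact (indepFun_iff_map_prod_eq_prod_map_map (hZ _ (by omega)).aemeasurable
    (hX.mono (pastSigma_le hZ n) le_rfl).aemeasurable).1 h1

end Iterates

/-! ### Entries, symmetry and norms of Hessians and matrices -/

section Entries

variable {p : ℕ}

lemma gradient_apply_eq_fderiv (f : Param p → ℝ) (x : Param p) (i : Fin p) :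
    gradient f x i = fderiv ℝ f x (EuclideanSpace.single i 1) := by
  have h := InnerProductSpace.toDual_symm_apply (𝕜 := ℝ) (x := EuclideanSpace.single i (1 : ℝ))
    (y := fderiv ℝ f x)
  rw [← h, EuclideanSpace.inner_single_right]
  simp only [gradient, conj_trivial, one_mul]

lemma hessian_apply (f : Param p → ℝ) (x : Param p) (i j : Fin p) :
    hessian f x i j = fderiv ℝ (gradient f) x (EuclideanSpace.single j 1) i := by
  have h : Matrix.toEuclideanCLM (n := Fin p) (𝕜 := ℝ) (hessian f x) = fderiv ℝ (gradient f) x := by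
    simp [hessian]
  rw [← h, Matrix.ofLp_toEuclideanCLM]
  simp [EuclideanSpace.single]

lemma hessian_apply_eq_fderiv {f : Param p → ℝ} {x : Param p}
    (hf : DifferentiableAt ℝ (gradient f) x) (i j : Fin p) :
    hessian f x i j = fderiv ℝ (fun y => gradient f y i) x (EuclideanSpace.single j 1) := by
  rw [hessian_apply]
  have h := ((EuclideanSpace.proj (𝕜 := ℝ) i).hasFDerivAt.comp x hf.hasFDerivAt).fderiv
  have h2 : (fun y => gradient f y i) = (EuclideanSpace.proj (𝕜 := ℝ) i) ∘ gradient f := rfl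
  rw [h2, h]
  rfl

lemma norm_hessian (f : Param p → ℝ) (x : Param p) :
    ‖hessian f x‖ = ‖fderiv ℝ (gradient f) x‖ := by
  rw [Matrix.cstar_norm_def]
  simp [hessian]

/-- Second derivatives are symmetric at a point once `f` is differentiable nearby; no continuity of
the second derivative is needed. The Riesz isometry transfers this to the derivative of the
gradient. -/
lemma isSymm_hessian {f : Param p → ℝ} {x : Param p} (hf : TwiceDifferentiableAt f x) :
    (hessian f x).IsHermitian := by
  ext i j
  simp only [Matrix.conjTranspose_apply, star_trivial]
  have h1 : fderiv ℝ f = fun y => InnerProductSpace.toDual ℝ (Param p) (gradient f y) := by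
    ext1 y; simp [gradient]
  have h2 : HasFDerivAt (fderiv ℝ f)
      ((InnerProductSpace.toDual ℝ (Param p)).toContinuousLinearEquiv.toContinuousLinearMap.comp
        (fderiv ℝ (gradient f) x)) x := by
    rw [h1]
    exact ((InnerProductSpace.toDual ℝ
      (Param p)).toContinuousLinearEquiv.toContinuousLinearMap.hasFDerivAt).comp x
        hf.2.hasFDerivAt
  have h3 := second_derivative_symmetric_of_eventually (𝕜 := ℝ)
    (hf.1.mono fun y hy => hy.hasFDerivAt) h2 (EuclideanSpace.single i 1)
    (EuclideanSpace.single j 1)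
  have h4 : ∀ a b : Fin p, inner ℝ (fderiv ℝ (gradient f) x (EuclideanSpace.single a 1))
      (EuclideanSpace.single b (1 : ℝ)) = hessian f x b a := by
    intro a b
    rw [hessian_apply, EuclideanSpace.inner_single_right]
    simp
  rw [← h4, ← h4]
  exact h3

lemma abs_apply_le_l2_opNorm (A : Matrix (Fin p) (Fin p) ℝ) (i j : Fin p) : |A i j| ≤ ‖A‖ := by
  have h1 := A.l2_opNorm_mulVec (EuclideanSpace.single j 1)
  have h2 := PiLp.norm_apply_le (WithLp.toLp 2
    (A *ᵥ (EuclideanSpace.single j (1 : ℝ)).ofLp) : Param p) i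
  simp [EuclideanSpace.single] at h1 h2
  exact h2.trans h1

/-- With `p` fixed, this crude bound suffices to prove all mean estimates entry by entry. -/
lemma l2_opNorm_le_sum_abs (A : Matrix (Fin p) (Fin p) ℝ) : ‖A‖ ≤ ∑ i, ∑ j, |A i j| := by
  rw [Matrix.cstar_norm_def]
  refine ContinuousLinearMap.opNorm_le_bound _
    (Finset.sum_nonneg fun i _ => Finset.sum_nonneg fun j _ => abs_nonneg _) fun x => ?_
  have h1 : ∀ v : Param p, ‖v‖ ≤ ∑ i, |v i| := by
    intro v
    have : v = ∑ i, EuclideanSpace.single i (v i) := by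
      ext k
      simp [Finset.sum_apply]
    conv_lhs => rw [this]
    refine (norm_sum_le _ _).trans (le_of_eq ?_)
    simp
  refine (h1 _).trans ?_
  rw [Finset.sum_mul]
  refine Finset.sum_le_sum fun i _ => ?_
  rw [Matrix.ofLp_toEuclideanCLM, Finset.sum_mul, Matrix.mulVec, dotProduct]
  refine (Finset.abs_sum_le_sum_abs _ _).trans (Finset.sum_le_sum fun j _ => ?_)
  rw [abs_mul]
  gcongr
  exact PiLp.norm_apply_le x j

lemma aestronglyMeasurable_matrix {Ω : Type*} [MeasurableSpace Ω] {μ : Measure Ω}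
    {A : Ω → Matrix (Fin p) (Fin p) ℝ} (hA : ∀ i j, AEStronglyMeasurable (fun ω => A ω i j) μ) :
    AEStronglyMeasurable A μ := by
  have h : A = fun ω => ∑ i, ∑ j, A ω i j • Matrix.single i j (1 : ℝ) := by
    ext1 ω
    conv_lhs => rw [Matrix.matrix_eq_sum_single (A ω)]
    simp
  rw [h]
  refine Finset.aestronglyMeasurable_fun_sum _ fun i _ =>
    Finset.aestronglyMeasurable_fun_sum _ fun j _ => (hA i j).smul_const _

end Entries

/-! ### Joint measurability of derivatives in datum and parameter -/

section ParametricMeasurability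

variable {p : ℕ} {S : Type*} [MeasurableSpace S]

/-- A directional derivative is the pointwise limit of difference quotients with increments v/n,
each jointly measurable. -/
lemma measurable_fderiv_apply_param {F : S → Param p → ℝ}
    (hF : Measurable (Function.uncurry F)) (hd : ∀ z, Differentiable ℝ (F z)) (v : Param p) :
    Measurable fun q : S × Param p => fderiv ℝ (F q.1) q.2 v := by
  refine measurable_of_tendsto_metrizable
    (f := fun (n : ℕ) q => (n : ℝ) * (F q.1 (q.2 + (n : ℝ)⁻¹ • v) - F q.1 q.2)) ?_ ?_
  · intro n
    exact ((hF.comp (measurable_fst.prodMk (measurable_snd.add_const _))).sub hF).const_mul _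
  · rw [tendsto_pi_nhds]
    intro q
    refine (hd q.1 q.2).hasFDerivAt.lim v ?_
    simpa using tendsto_natCast_atTop_atTop (R := ℝ)

/-- Jointly measurable versions of the gradient and of the Hessian of a sample function. -/
lemma exists_measurable_gradient_hessian {P : Measure S} {ℓ : S → Param p → ℝ}
    (hmeas : ∀ θ, Measurable fun z => ℓ z θ)
    (hdiff : ∀ᵐ z ∂P, Differentiable ℝ (ℓ z) ∧ Differentiable ℝ (gradient (ℓ z))) :
    ∃ (G : S → Param p → Param p) (K : S → Param p → Matrix (Fin p) (Fin p) ℝ),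
      Measurable (Function.uncurry G) ∧
      (∀ i j, Measurable fun q : S × Param p => K q.1 q.2 i j) ∧
      ∀ᵐ z ∂P, gradient (ℓ z) = G z ∧ hessian (ℓ z) = K z := by
  classical
  -- Replacing the sample function by 0 on a measurable null set containing all bad data makes it
  -- differentiable everywhere without losing measurability.
  obtain ⟨N, hN, hNm, hN0⟩ := exists_measurable_superset_of_null (ae_iff.1 hdiff)
  let f : S → Param p → ℝ := fun z => if z ∈ N then 0 else ℓ z
  have hf : ∀ z ∉ N, f z = ℓ z := fun z hz => if_neg hz
  have hd : ∀ z, Differentiable ℝ (f z) ∧ Differentiable ℝ (gradient (f z)) := by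
    intro z
    by_cases hz : z ∈ N
    · have h0 : f z = 0 := if_pos hz
      have h1 : gradient (0 : Param p → ℝ) = 0 := by
        ext1 x
        simp [gradient]
      rw [h0, h1]
      exact ⟨differentiable_const (0 : ℝ), differentiable_const (0 : Param p)⟩
    · rw [hf z hz]
      by_contra h
      exact hz (hN h)
  have hfm : Measurable (Function.uncurry f) := by
    suffices h : ∀ θ, Measurable fun z => f z θ from
      (measurable_uncurry_of_continuous_of_measurable (u := fun θ z => f z θ)
        (fun z => (hd z).1.continuous) h).comp measurable_swap
    intro θ
    have : (fun z => f z θ) = fun z => if z ∈ N then 0 else ℓ z θ := by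
      ext z
      simp only [f]
      split_ifs <;> rfl
    rw [this]
    exact Measurable.ite hNm measurable_const (hmeas θ)
  have hgi : ∀ i, Measurable fun q : S × Param p => gradient (f q.1) q.2 i := fun i => by
    simp only [gradient_apply_eq_fderiv]
    exact measurable_fderiv_apply_param hfm (fun z => (hd z).1) _
  refine ⟨fun z => gradient (f z), fun z => hessian (f z), ?_, ?_, ?_⟩
  · have : Function.uncurry (fun z => gradient (f z)) =
        fun q => WithLp.toLp 2 fun i => gradient (f q.1) q.2 i := by
      ext q i
      rfl
    rw [this]
    exact (WithLp.measurable_toLp 2 _).comp (measurable_pi_lambda _ hgi)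
  · intro i j
    have : (fun q : S × Param p => hessian (f q.1) q.2 i j) =
        fun q => fderiv ℝ ((fun z y => gradient (f z) y i) q.1) q.2
          (EuclideanSpace.single j 1) := by
      ext q
      exact hessian_apply_eq_fderiv ((hd q.1).2 q.2) i j
    rw [this]
    refine measurable_fderiv_apply_param (F := fun z y => gradient (f z) y i) (hgi i) (fun z => ?_) _
    exact (EuclideanSpace.proj (𝕜 := ℝ) i).differentiable.comp (hd z).2
  · have : ∀ᵐ z ∂P, z ∉ N := by
      rw [ae_iff]; simpa using hN0
    filter_upwards [this] with z hz
    rw [hf z hz]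
    exact ⟨rfl, rfl⟩

end ParametricMeasurability

/-! ### Moments at the minimizer and differentiation under the expectation -/

section Interchange

variable {p : ℕ} {S : Type*} [MeasurableSpace S] {P : Measure S}
  {ℓ : S → Param p → ℝ} {θs : Param p} {β : S → ℝ} {σ M L₄ : ℝ}

lemma ae_differentiable (hsmooth : SmoothAround P ℓ θs β) (hhess : HessianLipschitzAt P ℓ θs M) :
    ∀ᵐ z ∂P, Differentiable ℝ (ℓ z) ∧ Differentiable ℝ (gradient (ℓ z)) := by
  filter_upwards [hsmooth.2, hhess] with z h1 h2
  exact ⟨h1.1.differentiable one_ne_zero, fun θ => (h2 θ).1.2⟩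

lemma aemeasurable_gradient (hconv : ConvexIntegrable P ℓ) (hsmooth : SmoothAround P ℓ θs β)
    (hhess : HessianLipschitzAt P ℓ θs M) (θ : Param p) :
    AEMeasurable (fun z => gradient (ℓ z) θ) P := by
  obtain ⟨G, K, hG, -, hGK⟩ := exists_measurable_gradient_hessian (fun θ => (hconv.2 θ).1)
    (ae_differentiable hsmooth hhess)
  refine ⟨fun z => G z θ, hG.comp (measurable_id.prodMk measurable_const), ?_⟩
  filter_upwards [hGK] with z hz
  rw [hz.1]

lemma aemeasurable_hessian_apply (hconv : ConvexIntegrable P ℓ) (hsmooth : SmoothAround P ℓ θs β)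
    (hhess : HessianLipschitzAt P ℓ θs M) (θ : Param p) (i j : Fin p) :
    AEMeasurable (fun z => hessian (ℓ z) θ i j) P := by
  obtain ⟨G, K, -, hK, hGK⟩ := exists_measurable_gradient_hessian (fun θ => (hconv.2 θ).1)
    (ae_differentiable hsmooth hhess)
  refine ⟨fun z => K z θ i j, (hK i j).comp (measurable_id.prodMk measurable_const), ?_⟩
  filter_upwards [hGK] with z hz
  rw [hz.2]

lemma memLp_gradient (hconv : ConvexIntegrable P ℓ) (hsmooth : SmoothAround P ℓ θs β)
    (hnoise : NoiseLevel P ℓ θs σ) (hhess : HessianLipschitzAt P ℓ θs M) (θ : Param p) :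
    MemLp (fun z => gradient (ℓ z) θ) 2 P := by
  have h1 : MemLp (fun z => gradient (ℓ z) θs) 2 P :=
    (memLp_two_iff_integrable_sq_norm
      (aemeasurable_gradient hconv hsmooth hhess θs).aestronglyMeasurable).2 hnoise.1
  refine MemLp.of_le (h1.norm.add (hsmooth.1.mul_const ‖θ - θs‖))
    (aemeasurable_gradient hconv hsmooth hhess θ).aestronglyMeasurable ?_
  filter_upwards [hsmooth.2] with z hz
  refine le_trans ?_ (le_abs_self _)
  have h3 := norm_le_insert' (gradient (ℓ z) θ) (gradient (ℓ z) θs)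
  have h4 := hz.2 θ
  simp only [Pi.add_apply]
  linarith

/-- For a symmetric matrix, the i-th diagonal entry of the square is the sum of squares of row i, so
integrability of the squared Hessian controls every entry in L². -/
lemma memLp_hessian_apply (hconv : ConvexIntegrable P ℓ) (hsmooth : SmoothAround P ℓ θs β)
    (hhess : HessianLipschitzAt P ℓ θs M) (hhess2 : HessianSecondMoment P ℓ θs L₄)
    (i j : Fin p) : MemLp (fun z => hessian (ℓ z) θs i j) 2 P := by
  have hm := aemeasurable_hessian_apply hconv hsmooth hhess θs i j
  rw [memLp_two_iff_integrable_sq hm.aestronglyMeasurable]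
  refine (hhess2.1 i i).mono' (hm.pow_const 2).aestronglyMeasurable ?_
  filter_upwards [hhess] with z hz
  have hsymm := isSymm_hessian (hz θs).1
  rw [Real.norm_of_nonneg (sq_nonneg _), sq (hessian (ℓ z) θs), Matrix.mul_apply]
  have h : ∀ k, hessian (ℓ z) θs i k * hessian (ℓ z) θs k i = hessian (ℓ z) θs i k ^ 2 := by
    intro k
    rw [sq, ← hsymm.apply k i]
    simp
  simp only [h]
  exact Finset.single_le_sum (f := fun k => hessian (ℓ z) θs i k ^ 2)
    (fun k _ => sq_nonneg _) (Finset.mem_univ j)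

lemma gradient_objective_minimizer (hθs : IsMinOn (objective P ℓ) Set.univ θs) :
    gradient (objective P ℓ) θs = 0 := by
  have h : IsLocalMin (objective P ℓ) θs := hθs.isLocalMin univ_mem
  simp [gradient, h.fderiv_eq_zero]

variable [IsProbabilityMeasure P]

/-- Dominated differentiation on a unit ball: there the sample gradient is controlled by its value
at `θs` and a multiple of `|β|`, both integrable. -/
lemma hasGradientAt_objective (hconv : ConvexIntegrable P ℓ) (hsmooth : SmoothAround P ℓ θs β)
    (hnoise : NoiseLevel P ℓ θs σ) (hhess : HessianLipschitzAt P ℓ θs M) (θ : Param p) :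
    HasGradientAt (objective P ℓ) (∫ z, gradient (ℓ z) θ ∂P) θ := by
  have hint : ∀ θ, Integrable (fun z => gradient (ℓ z) θ) P := fun θ =>
    (memLp_gradient hconv hsmooth hnoise hhess θ).integrable one_le_two
  have hβ : Integrable β P := hsmooth.1.integrable one_le_two
  have h := hasFDerivAt_integral_of_dominated_of_fderiv_le (μ := P) (𝕜 := ℝ)
    (F := fun θ z => ℓ z θ)
    (F' := fun θ z => InnerProductSpace.toDual ℝ (Param p) (gradient (ℓ z) θ)) (x₀ := θ)
    (bound := fun z => ‖gradient (ℓ z) θs‖ + |β z| * (‖θ - θs‖ + 1))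
    (Metric.ball_mem_nhds θ one_pos)
    (Eventually.of_forall fun θ => (hconv.2 θ).1.aestronglyMeasurable) (hconv.2 θ).2
    ((InnerProductSpace.toDual ℝ (Param p)).continuous.comp_aestronglyMeasurable
      (hint θ).aestronglyMeasurable) ?_ ?_ ?_
  · rw [hasGradientAt_iff_hasFDerivAt]
    have e : InnerProductSpace.toDual ℝ (Param p) (∫ z, gradient (ℓ z) θ ∂P) =
        ∫ z, InnerProductSpace.toDual ℝ (Param p) (gradient (ℓ z) θ) ∂P :=
      (((InnerProductSpace.toDual ℝ
        (Param p)).toContinuousLinearEquiv.toContinuousLinearMap).integral_comp_comm (hint θ)).symm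
    rw [e]
    exact h
  · filter_upwards [hsmooth.2] with z hz x hx
    rw [LinearIsometryEquiv.norm_map]
    have h1 := norm_le_insert' (gradient (ℓ z) x) (gradient (ℓ z) θs)
    have h2 := hz.2 x
    have h3 : ‖x - θs‖ ≤ ‖θ - θs‖ + 1 := by
      have h4 := norm_sub_le_norm_sub_add_norm_sub x θ θs
      have h5 := mem_ball_iff_norm.1 hx
      linarith
    have h6 : β z * ‖x - θs‖ ≤ |β z| * (‖θ - θs‖ + 1) := by
      gcongr
      exact le_abs_self _
    linarith
  · exact (hint θs).norm.add (hβ.abs.mul_const _)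
  · filter_upwards [hsmooth.2] with z hz x _
    exact (hz.1.differentiable one_ne_zero x).hasGradientAt

lemma gradient_objective (hconv : ConvexIntegrable P ℓ) (hsmooth : SmoothAround P ℓ θs β)
    (hnoise : NoiseLevel P ℓ θs σ) (hhess : HessianLipschitzAt P ℓ θs M) :
    gradient (objective P ℓ) = fun θ => ∫ z, gradient (ℓ z) θ ∂P :=
  funext fun θ => (hasGradientAt_objective hconv hsmooth hnoise hhess θ).gradient

lemma integral_gradient_minimizer (hconv : ConvexIntegrable P ℓ) (hsmooth : SmoothAround P ℓ θs β)
    (hnoise : NoiseLevel P ℓ θs σ) (hhess : HessianLipschitzAt P ℓ θs M)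
    (hθs : IsMinOn (objective P ℓ) Set.univ θs) : ∫ z, gradient (ℓ z) θs ∂P = 0 := by
  rw [← gradient_objective_minimizer hθs, gradient_objective hconv hsmooth hnoise hhess]

/-- Identifies the limit of the Hessian average. Near `θs` the sample Hessians are dominated by
their norm at `θs` plus `|M|`, so the gradient can be differentiated under the integral. -/
lemma hessian_objective_apply (hconv : ConvexIntegrable P ℓ) (hsmooth : SmoothAround P ℓ θs β)
    (hnoise : NoiseLevel P ℓ θs σ) (hhess : HessianLipschitzAt P ℓ θs M)
    (hhess2 : HessianSecondMoment P ℓ θs L₄) (i j : Fin p) :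
    hessian (objective P ℓ) θs i j = ∫ z, hessian (ℓ z) θs i j ∂P := by
  have hint : ∀ θ, Integrable (fun z => gradient (ℓ z) θ) P := fun θ =>
    (memLp_gradient hconv hsmooth hnoise hhess θ).integrable one_le_two
  have hK : ∀ i j, Integrable (fun z => hessian (ℓ z) θs i j) P := fun i j =>
    (memLp_hessian_apply hconv hsmooth hhess hhess2 i j).integrable one_le_two
  have hKm : AEStronglyMeasurable (fun z => hessian (ℓ z) θs) P :=
    aestronglyMeasurable_matrix fun i j => (hK i j).aestronglyMeasurable
  have hKn : Integrable (fun z => hessian (ℓ z) θs) P := by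
    refine (integrable_finsetSum Finset.univ fun i _ =>
      integrable_finsetSum Finset.univ fun j _ => (hK i j).abs).mono' hKm ?_
    exact Eventually.of_forall fun z => l2_opNorm_le_sum_abs _
  have hD : (fun z => fderiv ℝ (gradient (ℓ z)) θs) =
      fun z => Matrix.toEuclideanCLM (n := Fin p) (𝕜 := ℝ) (hessian (ℓ z) θs) := by
    ext1 z
    simp [hessian]
  have hcont : Continuous (Matrix.toEuclideanCLM (n := Fin p) (𝕜 := ℝ)) :=
    LinearMap.continuous_of_finiteDimensional
      (Matrix.toEuclideanCLM (n := Fin p) (𝕜 := ℝ)).toAlgEquiv.toLinearMap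
  have hDm : AEStronglyMeasurable (fun z => fderiv ℝ (gradient (ℓ z)) θs) P := by
    rw [hD]
    exact hcont.comp_aestronglyMeasurable hKm
  have hDi : Integrable (fun z => fderiv ℝ (gradient (ℓ z)) θs) P := by
    refine hKn.norm.mono' hDm (Eventually.of_forall fun z => ?_)
    rw [norm_hessian]
  have h := hasFDerivAt_integral_of_dominated_of_fderiv_le (μ := P) (𝕜 := ℝ)
    (F := fun θ z => gradient (ℓ z) θ)
    (F' := fun θ z => fderiv ℝ (gradient (ℓ z)) θ) (x₀ := θs)
    (bound := fun z => ‖hessian (ℓ z) θs‖ + |M|)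
    (Metric.ball_mem_nhds θs one_pos)
    (Eventually.of_forall fun θ => (hint θ).aestronglyMeasurable) (hint θs) hDm ?_
    (hKn.norm.add (integrable_const _)) ?_
  · rw [← gradient_objective hconv hsmooth hnoise hhess] at h
    rw [hessian_apply, h.fderiv, ContinuousLinearMap.integral_apply hDi]
    have h2 := (EuclideanSpace.proj (𝕜 := ℝ) i).integral_comp_comm
      (hDi.apply_continuousLinearMap (EuclideanSpace.single j 1))
    simp only [hessian_apply]
    exact h2.symm
  · filter_upwards [hhess] with z hz x hx
    rw [← norm_hessian]
    have h1 := norm_le_insert' (hessian (ℓ z) x) (hessian (ℓ z) θs)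
    have h2 := (hz x).2
    have h5 := (mem_ball_iff_norm.1 hx).le
    have h6 : M * ‖x - θs‖ ≤ |M| * 1 := by
      gcongr
      exact le_abs_self _
    linarith
  · filter_upwards [hhess] with z hz x _
    exact (hz x).1.2.hasFDerivAt

end Interchange

/-! ### One-step contraction of the proximal map -/

section Contraction

variable {p : ℕ}

lemma gradient_mem_subdifferential {f : Param p → ℝ} (hf : ConvexOn ℝ Set.univ f) {x : Param p}
    (hd : DifferentiableAt ℝ f x) : gradient f x ∈ subdifferential f x := by
  intro y
  have h1 : Tendsto (fun n : ℕ => (n : ℝ) • (f (x + (n : ℝ)⁻¹ • (y - x)) - f x)) atTop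
      (𝓝 (fderiv ℝ f x (y - x))) :=
    hd.hasFDerivAt.lim (y - x) (by simpa using tendsto_natCast_atTop_atTop (R := ℝ))
  have h2 : inner ℝ (gradient f x) (y - x) = fderiv ℝ f x (y - x) := by
    simp [gradient]
  rw [h2]
  have h3 : fderiv ℝ f x (y - x) ≤ f y - f x := by
    refine le_of_tendsto h1 ?_
    filter_upwards [eventually_ge_atTop 1] with n hn
    have hn' : (1 : ℝ) ≤ n := by exact_mod_cast hn
    have h4 := hf.2 (Set.mem_univ x) (Set.mem_univ y)
      (sub_nonneg.2 (inv_le_one_of_one_le₀ hn')) (by positivity : 0 ≤ (n : ℝ)⁻¹) (by ring)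
    have h5 : (1 - (n : ℝ)⁻¹) • x + (n : ℝ)⁻¹ • y = x + (n : ℝ)⁻¹ • (y - x) := by module
    rw [h5] at h4
    simp only [smul_eq_mul] at h4 ⊢
    have h6 := mul_le_mul_of_nonneg_left h4 (by positivity : (0 : ℝ) ≤ n)
    have h7 : (n : ℝ) * ((1 - (n : ℝ)⁻¹) * f x + (n : ℝ)⁻¹ * f y) = n * f x - f x + f y := by
      field_simp
    rw [h7] at h6
    linarith
  linarith

/-- The difference of the two sides is the form at `u - v`, which is nonnegative. -/
lemma quadForm_add_le {A : Matrix (Fin p) (Fin p) ℝ} (hA : A.PosSemidef) (u v : Fin p → ℝ) :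
    (u + v) ⬝ᵥ A *ᵥ (u + v) ≤ 2 * (u ⬝ᵥ A *ᵥ u) + 2 * (v ⬝ᵥ A *ᵥ v) := by
  have h : 0 ≤ (u - v) ⬝ᵥ A *ᵥ (u - v) := by simpa using hA.dotProduct_mulVec_nonneg (u - v)
  simp only [Matrix.mulVec_add, Matrix.mulVec_sub, dotProduct_add, add_dotProduct,
    dotProduct_sub, sub_dotProduct] at h ⊢
  linarith

lemma quadForm_le (A : Matrix (Fin p) (Fin p) ℝ) (u : Param p) :
    u.ofLp ⬝ᵥ A *ᵥ u.ofLp ≤ ‖A‖ * ‖u‖ ^ 2 := by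
  have h1 := Matrix.inner_toEuclideanCLM A u u
  have h2 := real_inner_le_norm u (Matrix.toEuclideanCLM (n := Fin p) (𝕜 := ℝ) A u)
  have h3 := (Matrix.toEuclideanCLM (n := Fin p) (𝕜 := ℝ) A).le_opNorm u
  rw [← Matrix.cstar_norm_def] at h3
  have h4 : inner ℝ u (Matrix.toEuclideanCLM (n := Fin p) (𝕜 := ℝ) A u)
      = u.ofLp ⬝ᵥ A *ᵥ u.ofLp := by
    rw [h1]
  rw [← h4]
  nlinarith [norm_nonneg u]

/-- One step of the proximal method contracts towards `x₀`, up to a noise term. -/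
lemma sq_norm_prox_sub_le {f : Param p → ℝ} (hf : ConvexOn ℝ Set.univ f) {c : ℝ} (hc : 0 < c)
    {x₀ s : Param p} (hs : s ∈ subdifferential f x₀) {A : Matrix (Fin p) (Fin p) ℝ}
    (hA : A.PosSemidef) (hM : MConvexAt A f x₀) {w : ℝ} (hw0 : 0 ≤ w) (hw1 : w ≤ 1)
    (hw : 2 * c * w * ‖A‖ ≤ 1) (x : Param p) :
    ‖prox c f x - x₀‖ ^ 2 ≤ ‖x - x₀‖ ^ 2
      - c / 2 * (w * ((x - x₀).ofLp ⬝ᵥ A *ᵥ (x - x₀).ofLp))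
      - 2 * c * inner ℝ s (x - x₀) + 2 * c ^ 2 * ‖s‖ ^ 2 := by
  set u := prox c f x
  have h1 := prox_spec hf hc x x₀
  have h2 := hM s hs u
  have h3 := quadForm_add_le hA (u - x₀).ofLp (x - u).ofLp
  have h4 := quadForm_le A (x - u)
  have h5 : (u - x₀).ofLp + (x - u).ofLp = (x - x₀).ofLp := by
    rw [← WithLp.ofLp_add]; congr 1; abel
  rw [h5] at h3
  have h6 : inner ℝ s (u - x₀) = inner ℝ s (x - x₀) - inner ℝ s (x - u) := by
    rw [← inner_sub_right]; congr 1; abel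
  have h7 : 0 ≤ (u - x₀).ofLp ⬝ᵥ A *ᵥ (u - x₀).ofLp := by
    simpa using hA.dotProduct_mulVec_nonneg (u - x₀).ofLp
  have h8 := real_inner_le_norm s (x - u)
  rw [norm_sub_rev x₀ u, norm_sub_rev x₀ x, norm_sub_rev u x] at h1
  set q := (x - x₀).ofLp ⬝ᵥ A *ᵥ (x - x₀).ofLp
  set q1 := (u - x₀).ofLp ⬝ᵥ A *ᵥ (u - x₀).ofLp
  set q2 := (x - u).ofLp ⬝ᵥ A *ᵥ (x - u).ofLp
  set i1 := inner ℝ s (x - x₀)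
  set i2 := inner ℝ s (x - u)
  have h9 : 2 * c * (f u + 1 / (2 * c) * ‖x - u‖ ^ 2 + 1 / (2 * c) * ‖u - x₀‖ ^ 2)
      ≤ 2 * c * (f x₀ + 1 / (2 * c) * ‖x - x₀‖ ^ 2) := by gcongr
  have e1 : 2 * c * (f u + 1 / (2 * c) * ‖x - u‖ ^ 2 + 1 / (2 * c) * ‖u - x₀‖ ^ 2)
      = 2 * c * f u + ‖x - u‖ ^ 2 + ‖u - x₀‖ ^ 2 := by field_simp
  have e2 : 2 * c * (f x₀ + 1 / (2 * c) * ‖x - x₀‖ ^ 2) = 2 * c * f x₀ + ‖x - x₀‖ ^ 2 := by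
    field_simp
  rw [e1, e2] at h9
  rw [h6] at h2
  -- Convexity gives curvature at the new point `u`, which depends on the sample. It is moved to the
  -- old point `x`, independent of the sample, so that expectations factor later; the weight `w`
  -- keeps the cost within ‖x - u‖². Half of this inequality enters the conclusion.
  have h10 : c * (w * q) ≤ 2 * (c * q1) + ‖x - u‖ ^ 2 := by
    have a1 : w * q ≤ w * (2 * q1 + 2 * q2) := mul_le_mul_of_nonneg_left h3 hw0
    have a2 : w * q1 ≤ q1 := mul_le_of_le_one_left h7 hw1
    have a3 : 2 * c * w * q2 ≤ 2 * c * w * (‖A‖ * ‖x - u‖ ^ 2) :=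
      mul_le_mul_of_nonneg_left h4 (by positivity)
    have a4 : 2 * c * w * ‖A‖ * ‖x - u‖ ^ 2 ≤ 1 * ‖x - u‖ ^ 2 :=
      mul_le_mul_of_nonneg_right hw (sq_nonneg _)
    have a5 := mul_le_mul_of_nonneg_left a1 hc.le
    have a6 := mul_le_mul_of_nonneg_left a2 hc.le
    nlinarith
  -- The proximal inequality offers one full ‖x - u‖²: one half pays for the inner product here, the
  -- other for the change of point above.
  have h11 : 2 * c * i2 ≤ 2 * c ^ 2 * ‖s‖ ^ 2 + 1 / 2 * ‖x - u‖ ^ 2 := by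
    nlinarith [sq_nonneg (2 * c * ‖s‖ - ‖x - u‖)]
  have h12 := mul_le_mul_of_nonneg_left h2 (by positivity : 0 ≤ 2 * c)
  nlinarith

end Contraction

/-! ### Positive definiteness of the damped mean curvature -/

section Quadratic

variable {p : ℕ} {S : Type*} [MeasurableSpace S] {P : Measure S}

/-- By homogeneity `m` can be the minimum of the form on the compact unit sphere; if the sphere is
empty, the space is trivial and any constant works. -/
lemma exists_pos_forall_le_quadForm {A : Matrix (Fin p) (Fin p) ℝ}
    (hA : ∀ x : Param p, x ≠ 0 → 0 < x.ofLp ⬝ᵥ A *ᵥ x.ofLp) :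
    ∃ m > 0, ∀ x : Param p, m * ‖x‖ ^ 2 ≤ x.ofLp ⬝ᵥ A *ᵥ x.ofLp := by
  by_cases hne : (Metric.sphere (0 : Param p) 1).Nonempty
  · obtain ⟨y, hy, hmin⟩ := (isCompact_sphere (0 : Param p) 1).exists_isMinOn hne
      (f := fun x : Param p => x.ofLp ⬝ᵥ A *ᵥ x.ofLp)
      (Continuous.continuousOn (by
        simp only [dotProduct, Matrix.mulVec]
        fun_prop))
    have hy1 : ‖y‖ = 1 := by simpa using hy
    refine ⟨_, hA y (by rintro rfl; simp at hy1), fun x => ?_⟩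
    by_cases hx : x = 0
    · simp [hx]
    · have hx' : ‖x‖ ≠ 0 := by simpa using hx
      have h1 : y.ofLp ⬝ᵥ A *ᵥ y.ofLp ≤ (‖x‖⁻¹ • x).ofLp ⬝ᵥ A *ᵥ (‖x‖⁻¹ • x).ofLp := by
        refine hmin (show ‖x‖⁻¹ • x ∈ Metric.sphere (0 : Param p) 1 from ?_)
        simp [norm_smul, hx']
      simp only [WithLp.ofLp_smul, Matrix.mulVec_smul, dotProduct_smul, smul_dotProduct,
        smul_eq_mul] at h1
      have h2 := mul_le_mul_of_nonneg_right h1 (sq_nonneg ‖x‖)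
      refine h2.trans (le_of_eq ?_)
      field_simp
  · refine ⟨1, one_pos, fun x => ?_⟩
    by_cases hx : x = 0
    · simp [hx]
    · have hx' : ‖x‖ ≠ 0 := by simpa using hx
      exact absurd ⟨‖x‖⁻¹ • x, by simp [norm_smul, hx']⟩ hne

lemma integrable_quadForm {A : S → Matrix (Fin p) (Fin p) ℝ} (hA : IntegrableMat P A)
    (x : Fin p → ℝ) : Integrable (fun z => x ⬝ᵥ A z *ᵥ x) P := by
  simp only [dotProduct, Matrix.mulVec]
  exact integrable_finsetSum _ fun i _ => (integrable_finsetSum _ fun j _ =>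
    (hA i j).mul_const _).const_mul _

lemma quadForm_expectMat {A : S → Matrix (Fin p) (Fin p) ℝ} (hA : IntegrableMat P A)
    (x : Fin p → ℝ) : x ⬝ᵥ expectMat P A *ᵥ x = ∫ z, x ⬝ᵥ A z *ᵥ x ∂P := by
  simp only [dotProduct, Matrix.mulVec, expectMat, Matrix.of_apply]
  rw [integral_finsetSum _ fun i _ => (integrable_finsetSum _ fun j _ =>
    (hA i j).mul_const _).const_mul _]
  refine Finset.sum_congr rfl fun i _ => ?_
  rw [integral_const_mul, integral_finsetSum _ fun j _ => (hA i j).mul_const _]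
  simp only [integral_mul_const]

/-- The curvature matrix, damped so that its norm is at most `1 / b`. -/
noncomputable def damped (b : ℝ) (A : Matrix (Fin p) (Fin p) ℝ) : Matrix (Fin p) (Fin p) ℝ :=
  (1 + b * ‖A‖)⁻¹ • A

lemma integrableMat_damped [IsFiniteMeasure P] {A : S → Matrix (Fin p) (Fin p) ℝ}
    (hA : IntegrableMat P A) {b : ℝ} (hb : 0 ≤ b) :
    IntegrableMat P fun z => damped b (A z) := by
  intro i j
  have hm : AEStronglyMeasurable (fun z => ‖A z‖) P :=
    (aestronglyMeasurable_matrix fun i j => (hA i j).aestronglyMeasurable).norm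
  refine (hA i j).mono ?_ (Eventually.of_forall fun z => ?_)
  · simp only [damped, Matrix.smul_apply, smul_eq_mul]
    exact ((hm.const_mul b).const_add 1).aemeasurable.inv.aestronglyMeasurable.mul
      (hA i j).aestronglyMeasurable
  · simp only [damped, Matrix.smul_apply, smul_eq_mul, norm_mul]
    refine mul_le_of_le_one_left (norm_nonneg _) ?_
    rw [Real.norm_of_nonneg (by positivity)]
    exact inv_le_one_of_one_le₀ (by nlinarith [norm_nonneg (A z), mul_nonneg hb (norm_nonneg (A z))])

/-- Damping multiplies the form by a strictly positive factor. If its mean vanished at `x`, the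
undamped form would vanish almost surely at `x`, against positive definiteness of the mean. -/
lemma exists_pos_le_quadForm_damped [IsFiniteMeasure P] {A : S → Matrix (Fin p) (Fin p) ℝ}
    (hA : IntegrableMat P A) (hpsd : ∀ᵐ z ∂P, (A z).PosSemidef) (hpd : (expectMat P A).PosDef)
    {b : ℝ} (hb : 0 ≤ b) :
    ∃ m > 0, ∀ x : Param p,
      m * ‖x‖ ^ 2 ≤ x.ofLp ⬝ᵥ expectMat P (fun z => damped b (A z)) *ᵥ x.ofLp := by
  refine exists_pos_forall_le_quadForm fun x hx => ?_
  have hD := integrableMat_damped hA hb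
  have hx' : x.ofLp ≠ 0 := by simpa using hx
  have hpos : 0 < x.ofLp ⬝ᵥ expectMat P A *ᵥ x.ofLp := by
    simpa using hpd.dotProduct_mulVec_pos hx'
  rw [quadForm_expectMat hA] at hpos
  rw [quadForm_expectMat hD]
  have hform : ∀ z, x.ofLp ⬝ᵥ damped b (A z) *ᵥ x.ofLp
      = (1 + b * ‖A z‖)⁻¹ * (x.ofLp ⬝ᵥ A z *ᵥ x.ofLp) := by
    intro z
    simp only [damped, Matrix.smul_mulVec, dotProduct_smul, smul_eq_mul]
  have hnn : 0 ≤ᵐ[P] fun z => x.ofLp ⬝ᵥ damped b (A z) *ᵥ x.ofLp := by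
    filter_upwards [hpsd] with z hz
    have h1 : 0 ≤ x.ofLp ⬝ᵥ A z *ᵥ x.ofLp := by simpa using hz.dotProduct_mulVec_nonneg x.ofLp
    simp only [hform, Pi.zero_apply]
    positivity
  refine lt_of_le_of_ne (integral_nonneg_of_ae hnn) fun h0 => ?_
  have h1 := (integral_eq_zero_iff_of_nonneg_ae hnn (integrable_quadForm hD x.ofLp)).1 h0.symm
  have h2 : ∫ z, x.ofLp ⬝ᵥ A z *ᵥ x.ofLp ∂P = 0 := by
    refine integral_eq_zero_of_ae ?_
    filter_upwards [h1] with z hz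
    rw [hform] at hz
    have : 0 < (1 + b * ‖A z‖)⁻¹ := by positivity
    exact (mul_eq_zero.1 hz).resolve_left this.ne'
  linarith

end Quadratic

/-! ### Step-size comparisons and Chung's lemma -/

section StepSize

lemma stepSize_pos {γ₁ γ : ℝ} (hγ₁ : 0 < γ₁) {n : ℕ} (hn : 1 ≤ n) : 0 < stepSize γ₁ γ n := by
  have : (0 : ℝ) < n := by exact_mod_cast hn
  unfold stepSize
  positivity

lemma stepSize_le {γ₁ γ : ℝ} (hγ₁ : 0 < γ₁) (hγ : 0 ≤ γ) {n : ℕ} (hn : 1 ≤ n) :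
    stepSize γ₁ γ n ≤ γ₁ :=
  mul_le_of_le_one_right hγ₁.le
    (Real.rpow_le_one_of_one_le_of_nonpos (by exact_mod_cast hn) (by linarith))

lemma tendsto_stepSize {γ₁ γ : ℝ} (hγ : 0 < γ) :
    Tendsto (fun n : ℕ => stepSize γ₁ γ n) atTop (𝓝 0) := by
  have h := ((tendsto_rpow_neg_atTop hγ).comp tendsto_natCast_atTop_atTop).const_mul γ₁
  simpa [stepSize] using h

lemma stepSize_mul_le_succ {γ₁ γ : ℝ} (hγ₁ : 0 < γ₁) (hγ1 : γ ≤ 1) {n : ℕ} (hn1 : 1 ≤ n) :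
    stepSize γ₁ γ n * ((n : ℝ) / (n + 1)) ≤ stepSize γ₁ γ (n + 1) := by
  have hn0 : (0 : ℝ) < n := by exact_mod_cast hn1
  have hs := stepSize_pos (γ := γ) hγ₁ hn1
  have h7 : (n : ℝ) / (n + 1) ≤ ((n : ℝ) / (n + 1)) ^ γ := by
    conv_lhs => rw [← Real.rpow_one ((n : ℝ) / (n + 1))]
    refine Real.rpow_le_rpow_of_exponent_ge (by positivity) ?_ hγ1
    rw [div_le_one (by positivity)]; linarith
  have h8 : stepSize γ₁ γ (n + 1) = stepSize γ₁ γ n * ((n : ℝ) / (n + 1)) ^ γ := by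
    unfold stepSize
    rw [Real.div_rpow hn0.le (by positivity), Real.rpow_neg hn0.le, Real.rpow_neg (by positivity)]
    push_cast
    have : (0 : ℝ) < (n : ℝ) ^ γ := by positivity
    field_simp
  rw [h8]
  gcongr

/-- The relative decrease of the steps is at most 1/(n+1), which is o(γ_n) because γ < 1. -/
lemma eventually_stepSize_succ_ge {γ₁ γ κ : ℝ} (hγ₁ : 0 < γ₁) (hγ1 : γ < 1) (hκ : 0 < κ) :
    ∀ᶠ n : ℕ in atTop,
      stepSize γ₁ γ n * (1 - κ * stepSize γ₁ γ n) ≤ stepSize γ₁ γ (n + 1) := by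
  have h1 : Tendsto (fun n : ℕ => (n : ℝ) ^ (-(1 - γ))) atTop (𝓝 0) :=
    (tendsto_rpow_neg_atTop (by linarith)).comp tendsto_natCast_atTop_atTop
  filter_upwards [h1.eventually (gt_mem_nhds (show 0 < κ * γ₁ by positivity)),
    eventually_ge_atTop 1] with n hn hn1
  have hn0 : (0 : ℝ) < n := by exact_mod_cast hn1
  have hs := stepSize_pos (γ := γ) hγ₁ hn1
  have h2 : (1 : ℝ) / (n + 1) ≤ κ * stepSize γ₁ γ n := by
    have h3 : (n : ℝ) ^ (-(1 - γ)) = (n : ℝ)⁻¹ / (n : ℝ) ^ (-γ) := by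
      rw [show -(1 - γ) = (-1) - (-γ) by ring, Real.rpow_sub hn0, Real.rpow_neg_one]
    have h4 : (0 : ℝ) < (n : ℝ) ^ (-γ) := by positivity
    rw [h3, div_lt_iff₀ h4] at hn
    calc (1 : ℝ) / (n + 1) ≤ 1 / n := by gcongr; linarith
      _ = (n : ℝ)⁻¹ := one_div _
      _ ≤ κ * γ₁ * (n : ℝ) ^ (-γ) := hn.le
      _ = κ * stepSize γ₁ γ n := by rw [stepSize]; ring
  have h6 : (1 : ℝ) - 1 / (n + 1) = n / (n + 1) := by field_simp; ring
  have h5 := stepSize_mul_le_succ hγ₁ hγ1.le hn1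
  rw [← h6] at h5
  refine le_trans ?_ h5
  gcongr

/-- Chung's lemma for the step sizes `γ_n = γ₁ n^{-γ}`, `γ < 1`. -/
lemma exists_le_mul_stepSize {γ₁ γ κ C : ℝ} (hγ₁ : 0 < γ₁) (hγ0 : 0 < γ) (hγ1 : γ < 1)
    (hκ : 0 < κ) (hC : 0 ≤ C) {a : ℕ → ℝ} (ha : ∀ n, 0 ≤ a n)
    (hrec : ∀ n, a (n + 1) ≤ (1 - κ * stepSize γ₁ γ (n + 1)) * a n
      + C * stepSize γ₁ γ (n + 1) ^ 2) :
    ∃ K > 0, ∀ n, a n ≤ K * stepSize γ₁ γ (n + 1) := by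
  have hsp : ∀ n, 0 < stepSize γ₁ γ (n + 1) := fun n => stepSize_pos hγ₁ (by omega)
  have h1 := eventually_stepSize_succ_ge hγ₁ hγ1 (half_pos hκ)
  have h2 : ∀ᶠ n : ℕ in atTop, stepSize γ₁ γ n < 1 / κ :=
    (tendsto_stepSize hγ0).eventually (gt_mem_nhds (by positivity))
  obtain ⟨N, hN⟩ := eventually_atTop.1 (h1.and h2)
  have hterm : ∀ n, 0 ≤ a n / stepSize γ₁ γ (n + 1) := fun n => div_nonneg (ha n) (hsp n).le
  set B := ∑ n ∈ Finset.range (N + 1), a n / stepSize γ₁ γ (n + 1) with hB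
  have hB0 : 0 ≤ B := Finset.sum_nonneg fun n _ => hterm n
  -- `B` covers the finitely many indices up to `N`, `2 * C / κ` is what the induction needs, and 1
  -- ensures positivity.
  refine ⟨B + 2 * C / κ + 1, by positivity, fun n => ?_⟩
  set K := B + 2 * C / κ + 1 with hK
  have hinit : ∀ n ≤ N, a n ≤ K * stepSize γ₁ γ (n + 1) := by
    intro n hn
    rw [← div_le_iff₀ (hsp n)]
    have := Finset.single_le_sum (f := fun n => a n / stepSize γ₁ γ (n + 1))
      (fun n _ => hterm n) (Finset.mem_range.2 (Nat.lt_succ_of_le hn))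
    have h3 : 0 ≤ 2 * C / κ := by positivity
    linarith
  by_cases hn : n ≤ N
  · exact hinit n hn
  · induction n, (not_le.1 hn).le using Nat.le_induction with
    | base => exact hinit N le_rfl
    | succ n hNn ih =>
      have ih' : a n ≤ K * stepSize γ₁ γ (n + 1) := by
        by_cases h : n ≤ N
        · exact hinit n h
        · exact ih h
      obtain ⟨g1, g2⟩ := hN (n + 1) (by omega)
      set s := stepSize γ₁ γ (n + 1) with hs
      have hs0 : 0 < s := hsp n
      have g3 : 0 ≤ 1 - κ * s := by
        rw [lt_div_iff₀ hκ] at g2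
        linarith
      have g4 : C ≤ K * (κ / 2) := by
        have : 2 * C / κ * (κ / 2) = C := by field_simp
        rw [hK, add_mul, add_mul, this]
        nlinarith
      -- Half of the contraction rate absorbs the noise; the other half covers the decrease of the
      -- step size.
      calc a (n + 1) ≤ (1 - κ * s) * a n + C * s ^ 2 := hrec n
        _ ≤ (1 - κ * s) * (K * s) + K * (κ / 2) * s ^ 2 := by gcongr
        _ = K * (s * (1 - κ / 2 * s)) := by ring
        _ ≤ K * stepSize γ₁ γ (n + 1 + 1) := by gcongr

end StepSize

/-! ### Mean squared error of the iterates -/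

section SecondMoment

variable {p : ℕ} {S : Type*} [MeasurableSpace S] {P : Measure S}
  {ℓ : S → Param p → ℝ} {Ω : Type*} [MeasurableSpace Ω] {μ : Measure Ω}
  {Z : ℕ → Ω → S}

/-- The new sample is independent of anything determined by the past. This factorization does the
work of conditioning on the past in the moment estimates. -/
lemma integral_mul_of_past (hZ : ∀ k, 1 ≤ k → Measurable (Z k))
    (hlaw : ∀ k, 1 ≤ k → μ.map (Z k) = P) (hind : iIndepFun (fun k : ℕ => Z (k + 1)) μ)
    {n : ℕ} {E : Type*} [MeasurableSpace E] {X : Ω → E} (hX : Measurable[pastSigma Z n] X)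
    {a : S → ℝ} (ha : Integrable a P) {b : E → ℝ} (hb : Measurable b)
    (hbX : Integrable (fun ω => b (X ω)) μ) :
    Integrable (fun ω => a (Z (n + 1) ω) * b (X ω)) μ ∧
      ∫ ω, a (Z (n + 1) ω) * b (X ω) ∂μ = (∫ z, a z ∂P) * ∫ ω, b (X ω) ∂μ := by
  have hZn := hZ (n + 1) (by omega)
  have hXm : Measurable X := hX.mono (pastSigma_le hZ n) le_rfl
  have h1 : IndepFun (Z (n + 1)) X μ := by
    rw [IndepFun_iff_Indep]
    exact (indep_of_indep_of_le_left (indep_pastSigma hZ hind n) hX.comap_le).symm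
  rw [← hlaw (n + 1) (by omega)] at ha ⊢
  have h2 := h1.comp₀ hZn.aemeasurable hXm.aemeasurable ha.aestronglyMeasurable.aemeasurable
    hb.aemeasurable
  have haZ : Integrable (a ∘ Z (n + 1)) μ := ha.comp_aemeasurable hZn.aemeasurable
  refine ⟨h2.integrable_mul haZ hbX, ?_⟩
  rw [integral_map hZn.aemeasurable ha.aestronglyMeasurable]
  exact h2.integral_fun_mul_eq_mul_integral haZ.aestronglyMeasurable hbX.aestronglyMeasurable

lemma integrable_comp_data (hZ : ∀ k, 1 ≤ k → Measurable (Z k))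
    (hlaw : ∀ k, 1 ≤ k → μ.map (Z k) = P) {k : ℕ} (hk : 1 ≤ k) {a : S → ℝ} (ha : Integrable a P) :
    Integrable (fun ω => a (Z k ω)) μ := by
  rw [← hlaw k hk] at ha
  exact ha.comp_aemeasurable (hZ k hk).aemeasurable

lemma integral_comp_data (hZ : ∀ k, 1 ≤ k → Measurable (Z k))
    (hlaw : ∀ k, 1 ≤ k → μ.map (Z k) = P) {k : ℕ} (hk : 1 ≤ k) {a : S → ℝ} (ha : Integrable a P) :
    ∫ ω, a (Z k ω) ∂μ = ∫ z, a z ∂P := by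
  rw [← hlaw k hk] at ha ⊢
  exact (integral_map (hZ k hk).aemeasurable ha.aestronglyMeasurable).symm

lemma ae_comp_data (hZ : ∀ k, 1 ≤ k → Measurable (Z k))
    (hlaw : ∀ k, 1 ≤ k → μ.map (Z k) = P) {k : ℕ} (hk : 1 ≤ k) {q : S → Prop}
    (hq : ∀ᵐ z ∂P, q z) : ∀ᵐ ω ∂μ, q (Z k ω) := by
  rw [← hlaw k hk] at hq
  exact ae_of_ae_map (hZ k hk).aemeasurable hq

lemma quadForm_eq_sum (A : Matrix (Fin p) (Fin p) ℝ) (x : Fin p → ℝ) :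
    x ⬝ᵥ A *ᵥ x = ∑ i, ∑ j, A i j * (x i * x j) := by
  simp only [dotProduct, Matrix.mulVec, Finset.mul_sum]
  exact Finset.sum_congr rfl fun i _ => Finset.sum_congr rfl fun j _ => by ring

variable [IsProbabilityMeasure P] [IsProbabilityMeasure μ]
  {θs : Param p} {β : S → ℝ} {σ M : ℝ} {Λ : S → Matrix (Fin p) (Fin p) ℝ}

/-- Integrate the pointwise contraction with weight (1 + b‖Λ‖)⁻¹, admissible because `2 * c ≤ b`.
Coordinatewise, the curvature and linear terms are sums of products of a function of the new sample
and a function of `X`. The former averages to at least `m` times the squared distance, the latter to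
0 because the mean gradient at `θs` vanishes. -/
lemma sq_dist_prox_step (hZ : ∀ k, 1 ≤ k → Measurable (Z k))
    (hlaw : ∀ k, 1 ≤ k → μ.map (Z k) = P) (hind : iIndepFun (fun k : ℕ => Z (k + 1)) μ)
    (hθs : IsMinOn (objective P ℓ) Set.univ θs)
    (hconv : ConvexIntegrable P ℓ) (hsmooth : SmoothAround P ℓ θs β)
    (hstrong : StronglyConvexInMean P ℓ θs Λ) (hnoise : NoiseLevel P ℓ θs σ)
    (hhess : HessianLipschitzAt P ℓ θs M) {b c m : ℝ} (hc : 0 < c) (hcb : 2 * c ≤ b)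
    (hm : ∀ x : Param p,
      m * ‖x‖ ^ 2 ≤ x.ofLp ⬝ᵥ expectMat P (fun z => damped b (Λ z)) *ᵥ x.ofLp)
    {n : ℕ} {X : Ω → Param p} (hX : Measurable[pastSigma Z n] X)
    (hXi : Integrable (fun ω => ‖X ω - θs‖ ^ 2) μ) :
    Integrable (fun ω => ‖prox c (ℓ (Z (n + 1) ω)) (X ω) - θs‖ ^ 2) μ ∧
      ∫ ω, ‖prox c (ℓ (Z (n + 1) ω)) (X ω) - θs‖ ^ 2 ∂μ ≤
        (1 - m / 2 * c) * ∫ ω, ‖X ω - θs‖ ^ 2 ∂μ + 2 * σ ^ 2 * c ^ 2 := by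
  have hn : 1 ≤ n + 1 := by omega
  have hb : 0 ≤ b := by linarith
  have hXm : Measurable X := hX.mono (pastSigma_le hZ n) le_rfl
  have hXc : ∀ i, Integrable (fun ω => (X ω - θs) i) μ := by
    intro i
    have h2 : MemLp (fun ω => X ω - θs) 2 μ :=
      (memLp_two_iff_integrable_sq_norm (hXm.sub_const θs).aestronglyMeasurable).2 hXi
    refine (h2.integrable one_le_two).mono ?_ (Eventually.of_forall fun ω => PiLp.norm_apply_le _ i)
    exact (by fun_prop : Continuous fun x : Param p => (x - θs) i).comp_aestronglyMeasurable
      hXm.aestronglyMeasurable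
  have hXX : ∀ i j, Integrable (fun ω => (X ω - θs) i * (X ω - θs) j) μ := by
    intro i j
    refine hXi.mono' ?_ (Eventually.of_forall fun ω => ?_)
    · exact (by fun_prop : Continuous fun x : Param p =>
        (x - θs) i * (x - θs) j).comp_aestronglyMeasurable hXm.aestronglyMeasurable
    · rw [norm_mul, sq]
      exact mul_le_mul (PiLp.norm_apply_le _ i) (PiLp.norm_apply_le _ j) (norm_nonneg _)
        (norm_nonneg _)
  have hD := integrableMat_damped hstrong.2.1 hb
  have hquad : Integrable (fun ω => (X ω - θs).ofLp ⬝ᵥ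
        damped b (Λ (Z (n + 1) ω)) *ᵥ (X ω - θs).ofLp) μ ∧
      m * ∫ ω, ‖X ω - θs‖ ^ 2 ∂μ ≤ ∫ ω, (X ω - θs).ofLp ⬝ᵥ
        damped b (Λ (Z (n + 1) ω)) *ᵥ (X ω - θs).ofLp ∂μ := by
    have h1 := fun i j => integral_mul_of_past hZ hlaw hind hX (hD i j)
      (b := fun x : Param p => (x - θs) i * (x - θs) j) (by fun_prop) (hXX i j)
    simp only [quadForm_eq_sum]
    refine ⟨integrable_finsetSum _ fun i _ => integrable_finsetSum _ fun j _ => (h1 i j).1, ?_⟩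
    rw [integral_finsetSum _ fun i _ => integrable_finsetSum _ fun j _ => (h1 i j).1]
    have h2 : ∀ i, ∫ ω, ∑ j, damped b (Λ (Z (n + 1) ω)) i j * ((X ω - θs) i * (X ω - θs) j) ∂μ
        = ∫ ω, ∑ j, (∫ z, damped b (Λ z) i j ∂P) * ((X ω - θs) i * (X ω - θs) j) ∂μ := by
      intro i
      rw [integral_finsetSum _ fun j _ => (h1 i j).1,
        integral_finsetSum _ fun j _ => (hXX i j).const_mul _]
      refine Finset.sum_congr rfl fun j _ => ?_
      rw [(h1 i j).2, integral_const_mul]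
    simp only [h2]
    rw [← integral_finsetSum _ fun i _ => integrable_finsetSum _ fun j _ =>
      (hXX i j).const_mul _, ← integral_const_mul]
    refine integral_mono (hXi.const_mul m) (integrable_finsetSum _ fun i _ =>
      integrable_finsetSum _ fun j _ => (hXX i j).const_mul _) fun ω => ?_
    have h3 := hm (X ω - θs)
    rw [quadForm_eq_sum] at h3
    exact h3
  have hg := (memLp_gradient hconv hsmooth hnoise hhess θs).integrable one_le_two
  have hinner : Integrable (fun ω => inner ℝ (gradient (ℓ (Z (n + 1) ω)) θs) (X ω - θs)) μ ∧
      ∫ ω, inner ℝ (gradient (ℓ (Z (n + 1) ω)) θs) (X ω - θs) ∂μ = 0 := by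
    have hgi : ∀ i, Integrable (fun z => gradient (ℓ z) θs i) P := fun i =>
      (EuclideanSpace.proj (𝕜 := ℝ) i).integrable_comp hg
    have h1 := fun i => integral_mul_of_past hZ hlaw hind hX (hgi i)
      (b := fun x : Param p => (x - θs) i) (by fun_prop) (hXc i)
    have h2 : ∀ u v : Param p, inner ℝ u v = ∑ i, u i * v i := fun u v => by
      simp [PiLp.inner_apply, mul_comm]
    simp only [h2]
    refine ⟨integrable_finsetSum _ fun i _ => (h1 i).1, ?_⟩
    rw [integral_finsetSum _ fun i _ => (h1 i).1]
    refine Finset.sum_eq_zero fun i _ => ?_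
    have h3 : ∫ z, gradient (ℓ z) θs i ∂P = (∫ z, gradient (ℓ z) θs ∂P) i :=
      (EuclideanSpace.proj (𝕜 := ℝ) i).integral_comp_comm hg
    rw [(h1 i).2, h3, integral_gradient_minimizer hconv hsmooth hnoise hhess hθs]
    simp
  have hnz := integrable_comp_data hZ hlaw hn hnoise.1
  have hnz' := integral_comp_data hZ hlaw hn hnoise.1
  have hpt : ∀ᵐ ω ∂μ, ‖prox c (ℓ (Z (n + 1) ω)) (X ω) - θs‖ ^ 2 ≤ ‖X ω - θs‖ ^ 2
      - c / 2 * ((X ω - θs).ofLp ⬝ᵥ damped b (Λ (Z (n + 1) ω)) *ᵥ (X ω - θs).ofLp)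
      - 2 * c * inner ℝ (gradient (ℓ (Z (n + 1) ω)) θs) (X ω - θs)
      + 2 * c ^ 2 * ‖gradient (ℓ (Z (n + 1) ω)) θs‖ ^ 2 := by
    filter_upwards [ae_comp_data hZ hlaw hn hstrong.1, ae_comp_data hZ hlaw hn hsmooth.2]
      with ω h1 h2
    have hnA := norm_nonneg (Λ (Z (n + 1) ω))
    have hden : 0 < 1 + b * ‖Λ (Z (n + 1) ω)‖ := by positivity
    have h3 := sq_norm_prox_sub_le (hconv.1 (Z (n + 1) ω)) hc
      (gradient_mem_subdifferential (hconv.1 _) (h2.1.differentiable one_ne_zero θs)) h1.1 h1.2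
      (w := (1 + b * ‖Λ (Z (n + 1) ω)‖)⁻¹) (by positivity)
      (inv_le_one_of_one_le₀ (by nlinarith [mul_nonneg hb hnA])) ?_ (X ω)
    · simpa only [damped, Matrix.smul_mulVec, dotProduct_smul, smul_eq_mul] using h3
    · rw [mul_right_comm, mul_inv_le_iff₀ hden]
      nlinarith
  have hbound := ((hXi.sub (hquad.1.const_mul (c / 2))).sub (hinner.1.const_mul (2 * c))).add
    (hnz.const_mul (2 * c ^ 2))
  have hmeas : AEStronglyMeasurable (fun ω => ‖prox c (ℓ (Z (n + 1) ω)) (X ω) - θs‖ ^ 2) μ :=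
    ((((measurable_prox hconv.1 (fun θ => (hconv.2 θ).1) hc).comp
      ((hZ (n + 1) hn).prodMk hXm)).sub_const θs).norm.pow_const 2).aestronglyMeasurable
  have hint : Integrable (fun ω => ‖prox c (ℓ (Z (n + 1) ω)) (X ω) - θs‖ ^ 2) μ := by
    refine hbound.mono' hmeas ?_
    filter_upwards [hpt] with ω hω
    rw [Real.norm_of_nonneg (by positivity)]
    exact hω
  refine ⟨hint, (integral_mono_ae hint hbound hpt).trans ?_⟩
  rw [integral_add' ((hXi.sub (hquad.1.const_mul (c / 2))).sub (hinner.1.const_mul (2 * c)))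
      (hnz.const_mul (2 * c ^ 2)),
    integral_sub' (hXi.sub (hquad.1.const_mul (c / 2))) (hinner.1.const_mul (2 * c)),
    integral_sub' hXi (hquad.1.const_mul (c / 2))]
  simp only [integral_const_mul, hinner.2, hnz']
  have h4 := mul_le_mul_of_nonneg_left hquad.2 (half_pos hc).le
  have h5 := mul_le_mul_of_nonneg_left hnoise.2 (by positivity : 0 ≤ 2 * c ^ 2)
  linarith

/-- The mean squared error of the iterates is of the order of the step size. -/
theorem exists_sq_dist_iterate_le (hZ : ∀ k, 1 ≤ k → Measurable (Z k))
    (hlaw : ∀ k, 1 ≤ k → μ.map (Z k) = P) (hind : iIndepFun (fun k : ℕ => Z (k + 1)) μ)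
    (hθs : IsMinOn (objective P ℓ) Set.univ θs)
    (hconv : ConvexIntegrable P ℓ) (hsmooth : SmoothAround P ℓ θs β)
    (hstrong : StronglyConvexInMean P ℓ θs Λ) (hnoise : NoiseLevel P ℓ θs σ)
    (hhess : HessianLipschitzAt P ℓ θs M) {γ₁ γ : ℝ} (hγ₁ : 0 < γ₁) (hγ0 : 0 < γ) (hγ1 : γ < 1)
    (θ₀ : Param p) :
    ∃ K > 0, ∀ n,
      Integrable (fun ω => ‖iterate ℓ (stepSize γ₁ γ) θ₀ (fun k => Z k ω) n - θs‖ ^ 2) μ ∧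
      ∫ ω, ‖iterate ℓ (stepSize γ₁ γ) θ₀ (fun k => Z k ω) n - θs‖ ^ 2 ∂μ
        ≤ K * stepSize γ₁ γ (n + 1) := by
  -- Since every step is at most `γ₁`, the damping level `2 * γ₁` serves all of them, giving one
  -- constant `m` for the whole recursion.
  obtain ⟨m, hm0, hm⟩ := exists_pos_le_quadForm_damped hstrong.2.1
    (hstrong.1.mono fun z hz => hz.1) hstrong.2.2 (b := 2 * γ₁) (by positivity)
  have hstep := fun n => sq_dist_prox_step hZ hlaw hind hθs hconv hsmooth hstrong hnoise hhess
    (stepSize_pos (γ := γ) hγ₁ (show 1 ≤ n + 1 by omega))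
    (mul_le_mul_of_nonneg_left (stepSize_le hγ₁ hγ0.le (by omega)) zero_le_two) hm
    (measurable_iterate hconv.1 (fun θ => (hconv.2 θ).1)
      (fun n hn => stepSize_pos (γ := γ) hγ₁ hn) θ₀ Z n)
  have hint : ∀ n,
      Integrable (fun ω => ‖iterate ℓ (stepSize γ₁ γ) θ₀ (fun k => Z k ω) n - θs‖ ^ 2) μ := by
    intro n
    induction n with
    | zero => exact integrable_const (μ := μ) (‖θ₀ - θs‖ ^ 2)
    | succ n ih => exact (hstep n ih).1
  obtain ⟨K, hK, h⟩ := exists_le_mul_stepSize hγ₁ hγ0 hγ1 (half_pos hm0)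
    (C := 2 * σ ^ 2) (by positivity)
    (a := fun n => ∫ ω, ‖iterate ℓ (stepSize γ₁ γ) θ₀ (fun k => Z k ω) n - θs‖ ^ 2 ∂μ)
    (fun n => integral_nonneg fun ω => sq_nonneg _) (fun n => (hstep n (hint n)).2)
  exact ⟨K, hK, fun n => ⟨hint n, h n⟩⟩

end SecondMoment

/-! ### Fourth moment of the gradient at the minimizer -/

section FourthMoment

variable {p : ℕ} {S : Type*} [MeasurableSpace S] {P : Measure S} [IsProbabilityMeasure P]
  {ℓ : S → Param p → ℝ} {Ω : Type*} [MeasurableSpace Ω] {μ : Measure Ω} [IsProbabilityMeasure μ]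
  {Z : ℕ → Ω → S} {θs : Param p} {β : S → ℝ} {M Sig₃ Sig₄ : ℝ} {θ : ℕ → Ω → Param p}

lemma measurable_gradient (f : Param p → ℝ) : Measurable (gradient f) :=
  (InnerProductSpace.toDual ℝ (Param p)).symm.continuous.measurable.comp (measurable_fderiv ℝ f)

/-- The conditional fourth moment bound along the iterates yields points arbitrarily close to the
minimizer at which the centred gradient has a bounded fourth moment. -/
lemma exists_near_minimizer_fourth_moment_le (hZ : ∀ k, 1 ≤ k → Measurable (Z k))
    (hlaw : ∀ k, 1 ≤ k → μ.map (Z k) = P) (hind : iIndepFun (fun k : ℕ => Z (k + 1)) μ)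
    (hfourth : FourthMomentBound μ P ℓ Z θ θs Sig₃ Sig₄)
    (hθm : ∀ n, Measurable[pastSigma Z n] (θ n))
    (hint : ∀ n, Integrable (fun ω => ‖θ n ω - θs‖ ^ 2) μ)
    (hlim : Tendsto (fun n => ∫ ω, ‖θ n ω - θs‖ ^ 2 ∂μ) atTop (𝓝 0))
    {G : S → Param p → Param p} (hG : Measurable (Function.uncurry G))
    (hGℓ : ∀ᵐ z ∂P, gradient (ℓ z) = G z) {r : ℝ} (hr0 : 0 < r) (hr1 : r ≤ 1) :
    ∃ x, ‖x - θs‖ ≤ r ∧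
      ∫⁻ z, ENNReal.ofReal (‖gradient (objective P ℓ) x - G z x‖ ^ 4) ∂P
        ≤ ENNReal.ofReal (|Sig₃| + |Sig₄|) := by
  obtain ⟨n, hn⟩ := (hlim.eventually (gt_mem_nhds (show 0 < r ^ 2 by positivity))).exists
  have hle := pastSigma_le hZ n
  have hθn : Measurable (θ n) := (hθm n).mono hle le_rfl
  set B : Set (Param p) := Metric.closedBall θs r with hB
  have hBm : MeasurableSet B := Metric.isClosed_closedBall.measurableSet
  set A : Set Ω := θ n ⁻¹' B with hA
  have hAm : MeasurableSet[pastSigma Z n] A := hθm n hBm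
  have hAm' : MeasurableSet A := hθn hBm
  have hAB : ∀ ω ∈ A, ‖θ n ω - θs‖ ≤ r := fun ω hω => mem_closedBall_iff_norm.1 hω
  -- If θ_n almost surely missed the ball, its mean squared error would be at least r², contrary to
  -- the choice of `n`.
  have hA0 : μ A ≠ 0 := by
    intro h0
    have h1 : ∀ᵐ ω ∂μ, r ^ 2 ≤ ‖θ n ω - θs‖ ^ 2 := by
      have : ∀ᵐ ω ∂μ, ω ∉ A := by rw [ae_iff]; simpa using h0
      filter_upwards [this] with ω hω
      have h2 : r < ‖θ n ω - θs‖ := by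
        by_contra h
        exact hω (mem_closedBall_iff_norm.2 (not_lt.1 h))
      gcongr
    have h2 := integral_mono_ae (integrable_const (r ^ 2)) (hint n) h1
    simp only [integral_const, probReal_univ, smul_eq_mul, one_mul] at h2
    linarith
  obtain ⟨hε, hcond⟩ := hfourth (n + 1) (by omega)
  simp only [Nat.add_sub_cancel] at hε hcond
  set e : Ω → ℝ := fun ω =>
    ‖gradient (objective P ℓ) (θ n ω) - gradient (ℓ (Z (n + 1) ω)) (θ n ω)‖ ^ 4 with he
  set C : ℝ := |Sig₃| + |Sig₄| with hC
  have hC0 : 0 ≤ C := by positivity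
  -- The event `A` belongs to the past, so the conditional bound integrates over it; on `A` the
  -- distance is at most 1, which makes the bound independent of `r`.
  have h1 : ∫ ω in A, e ω ∂μ ≤ C * μ.real A := by
    rw [← setIntegral_condExp hle hε hAm]
    have h2 : ∫ ω in A, (μ[e | pastSigma Z n]) ω ∂μ ≤ ∫ ω in A, C ∂μ := by
      refine setIntegral_mono_on_ae integrable_condExp.integrableOn
        (integrable_const C).integrableOn hAm' ?_
      filter_upwards [hcond] with ω hω hωA
      refine hω.trans ?_
      have h3 : ‖θ n ω - θs‖ ^ 4 ≤ 1 :=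
        pow_le_one₀ (norm_nonneg _) ((hAB ω hωA).trans hr1)
      have h4 : Sig₄ * ‖θ n ω - θs‖ ^ 4 ≤ |Sig₄| * 1 := by
        gcongr
        exact le_abs_self _
      have h5 := le_abs_self Sig₃
      linarith
    rw [setIntegral_const, smul_eq_mul, mul_comm] at h2
    exact h2
  set F : S × Param p → ENNReal := fun q =>
    ENNReal.ofReal (‖gradient (objective P ℓ) q.2 - G q.1 q.2‖ ^ 4) with hF
  have hFm : Measurable F :=
    ((((measurable_gradient _).comp measurable_snd).sub hG).norm.pow_const 4).ennreal_ofReal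
  have hν : IsProbabilityMeasure (μ.map (θ n)) := Measure.isProbabilityMeasure_map hθn.aemeasurable
  have hpair := map_prodMk_eq_prod hZ hind n (hθm n)
  rw [hlaw (n + 1) (by omega)] at hpair
  -- Sample and iterate have a product law, so the integral over `A` is that of the fourth moment at
  -- a fixed point over the part of the law of θ_n in `B`. Some point of `B` does not exceed the
  -- average.
  have h6 : ∫⁻ x in B, ∫⁻ z, F (z, x) ∂P ∂(μ.map (θ n)) ≤ ENNReal.ofReal C * μ A := by
    calc ∫⁻ x in B, ∫⁻ z, F (z, x) ∂P ∂(μ.map (θ n))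
        = ∫⁻ x, ∫⁻ z, (Set.univ ×ˢ B).indicator F (z, x) ∂P ∂(μ.map (θ n)) := by
          rw [← lintegral_indicator hBm]
          refine lintegral_congr fun x => ?_
          by_cases hx : x ∈ B <;> simp [Set.indicator, hx]
      _ = ∫⁻ q, (Set.univ ×ˢ B).indicator F q ∂(P.prod (μ.map (θ n))) := by
          rw [lintegral_prod_symm _ (hFm.indicator (MeasurableSet.univ.prod hBm)).aemeasurable]
      _ = ∫⁻ ω, (Set.univ ×ˢ B).indicator F (Z (n + 1) ω, θ n ω) ∂μ := by
          rw [← hpair, lintegral_map (hFm.indicator (MeasurableSet.univ.prod hBm))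
            ((hZ (n + 1) (by omega)).prodMk hθn)]
      _ = ∫⁻ ω in A, F (Z (n + 1) ω, θ n ω) ∂μ := by
          rw [← lintegral_indicator hAm']
          refine lintegral_congr fun ω => ?_
          by_cases hx : θ n ω ∈ B <;> simp [Set.indicator, hx, hA]
      _ = ∫⁻ ω in A, ENNReal.ofReal (e ω) ∂μ := by
          refine lintegral_congr_ae (ae_restrict_of_ae ?_)
          filter_upwards [ae_comp_data hZ hlaw (show 1 ≤ n + 1 by omega) hGℓ] with ω hω
          simp only [hF, he, hω]
      _ = ENNReal.ofReal (∫ ω in A, e ω ∂μ) :=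
          (ofReal_integral_eq_lintegral_ofReal hε.integrableOn
            (Eventually.of_forall fun ω => by positivity)).symm
      _ ≤ ENNReal.ofReal (C * μ.real A) := ENNReal.ofReal_le_ofReal h1
      _ = ENNReal.ofReal C * μ A := by
          rw [ENNReal.ofReal_mul hC0, ofReal_measureReal]
  have hνB : μ.map (θ n) B = μ A := Measure.map_apply hθn hBm
  obtain ⟨x, hx, hxle⟩ := exists_le_setLAverage (μ := μ.map (θ n)) (s := B)
    (f := fun x => ∫⁻ z, F (z, x) ∂P) (by rwa [hνB]) (measure_ne_top _ _)
    hFm.lintegral_prod_left'.aemeasurable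
  refine ⟨x, mem_closedBall_iff_norm.1 hx, hxle.trans ?_⟩
  rw [setLAverage_eq, hνB]
  exact ENNReal.div_le_of_le_mul h6

/-- The gradient at the minimizer has a finite fourth moment. -/
lemma integrable_norm_gradient_pow_four (hZ : ∀ k, 1 ≤ k → Measurable (Z k))
    (hlaw : ∀ k, 1 ≤ k → μ.map (Z k) = P) (hind : iIndepFun (fun k : ℕ => Z (k + 1)) μ)
    (hθs : IsMinOn (objective P ℓ) Set.univ θs)
    (hconv : ConvexIntegrable P ℓ) (hsmooth : SmoothAround P ℓ θs β)
    (htwice : TwiceDifferentiableAt (objective P ℓ) θs)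
    (hhess : HessianLipschitzAt P ℓ θs M)
    (hfourth : FourthMomentBound μ P ℓ Z θ θs Sig₃ Sig₄)
    (hθm : ∀ n, Measurable[pastSigma Z n] (θ n))
    (hint : ∀ n, Integrable (fun ω => ‖θ n ω - θs‖ ^ 2) μ)
    (hlim : Tendsto (fun n => ∫ ω, ‖θ n ω - θs‖ ^ 2 ∂μ) atTop (𝓝 0)) :
    Integrable (fun z => ‖gradient (ℓ z) θs‖ ^ 4) P := by
  have hdiff := ae_differentiable hsmooth hhess
  obtain ⟨G, K, hG, -, hGK⟩ := exists_measurable_gradient_hessian (fun θ => (hconv.2 θ).1) hdiff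
  have hGℓ : ∀ᵐ z ∂P, gradient (ℓ z) = G z := hGK.mono fun z hz => hz.1
  have hex : ∀ k : ℕ, ∃ x, ‖x - θs‖ ≤ 1 / ((k : ℝ) + 1) ∧
      ∫⁻ z, ENNReal.ofReal (‖gradient (objective P ℓ) x - G z x‖ ^ 4) ∂P
        ≤ ENNReal.ofReal (|Sig₃| + |Sig₄|) := fun k =>
    exists_near_minimizer_fourth_moment_le hZ hlaw hind hfourth hθm hint hlim hG hGℓ
      (by positivity) (by rw [div_le_one (by positivity)]; linarith [(Nat.cast_nonneg k : (0:ℝ) ≤ k)])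
  choose x hx hxC using hex
  have hxlim : Tendsto x atTop (𝓝 θs) := by
    rw [tendsto_iff_norm_sub_tendsto_zero]
    exact squeeze_zero (fun _ => norm_nonneg _) hx tendsto_one_div_add_atTop_nhds_zero_nat
  have hmeas : ∀ y, Measurable fun z =>
      ENNReal.ofReal (‖gradient (objective P ℓ) y - G z y‖ ^ 4) := fun y =>
    ((measurable_const.sub (hG.comp (measurable_id.prodMk measurable_const))).norm.pow_const
      4).ennreal_ofReal
  -- Fatou along points tending to `θs`: the gradient of the objective tends to 0 there and the
  -- sample gradient is continuous, so the limit is the fourth power of the sample gradient norm at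
  -- `θs`.
  have hfatou := lintegral_liminf_le (μ := P) (u := atTop) fun k => hmeas (x k)
  have hlimz : ∀ᵐ z ∂P, liminf (fun k =>
      ENNReal.ofReal (‖gradient (objective P ℓ) (x k) - G z (x k)‖ ^ 4)) atTop
        = ENNReal.ofReal (‖gradient (ℓ z) θs‖ ^ 4) := by
    filter_upwards [hGℓ, hdiff] with z hz hd
    have h1 : Tendsto (fun k => gradient (objective P ℓ) (x k)) atTop (𝓝 0) := by
      have := htwice.2.continuousAt.tendsto.comp hxlim
      rwa [gradient_objective_minimizer hθs] at this
    have h2 : Tendsto (fun k => G z (x k)) atTop (𝓝 (gradient (ℓ z) θs)) := by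
      rw [← hz]
      exact (hd.2 θs).continuousAt.tendsto.comp hxlim
    have h3 := ENNReal.tendsto_ofReal ((h1.sub h2).norm.pow 4)
    rw [zero_sub, norm_neg] at h3
    exact h3.liminf_eq
  rw [lintegral_congr_ae hlimz] at hfatou
  have hle : ∫⁻ z, ENNReal.ofReal (‖gradient (ℓ z) θs‖ ^ 4) ∂P
      ≤ ENNReal.ofReal (|Sig₃| + |Sig₄|) :=
    hfatou.trans (liminf_le_of_le (by isBoundedDefault)
      fun b hb => by
        obtain ⟨k, hk⟩ := hb.exists
        exact hk.trans (hxC k))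
  refine ⟨((aemeasurable_gradient hconv hsmooth hhess θs).norm.pow_const 4).aestronglyMeasurable, ?_⟩
  rw [hasFiniteIntegral_iff_ofReal (Eventually.of_forall fun z => by positivity)]
  exact hle.trans_lt ENNReal.ofReal_lt_top

end FourthMoment

/-! ### Averages of perturbed i.i.d. samples -/

section Averages

lemma sum_Icc_one_eq_sum_range {E : Type*} [AddCommMonoid E] (f : ℕ → E) (n : ℕ) :
    ∑ k ∈ Finset.Icc 1 n, f k = ∑ k ∈ Finset.range n, f (k + 1) := by
  induction n with
  | zero => simp
  | succ n ih => rw [Finset.sum_Icc_succ_top (by omega), ih, Finset.sum_range_succ]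

/-- Since γ ≤ 1, the sampling rate n^{-1/2} never exceeds the order of γ_n^{1/2}. -/
lemma sqrt_le_sqrt_stepSize {γ₁ γ : ℝ} (hγ₁ : 0 < γ₁) (hγ1 : γ ≤ 1) {n : ℕ} (hn : 1 ≤ n) :
    √γ₁ / √n ≤ √(stepSize γ₁ γ n) := by
  have hn' : (1 : ℝ) ≤ n := by exact_mod_cast hn
  rw [← Real.sqrt_div hγ₁.le]
  apply Real.sqrt_le_sqrt
  rw [div_eq_mul_inv, ← Real.rpow_neg_one, stepSize]
  gcongr

/-- Induction reduces to 2n √γ_n ≤ (2n+1) √γ_{n+1}. After squaring and using γ_{n+1} ≥ γ_n n/(n+1),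
this is 4n(n+1) ≤ (2n+1)². -/
lemma sum_sqrt_stepSize_le {γ₁ γ : ℝ} (hγ₁ : 0 < γ₁) (hγ1 : γ ≤ 1) {n : ℕ} (hn : 1 ≤ n) :
    ∑ k ∈ Finset.Icc 1 n, √(stepSize γ₁ γ k) ≤ 2 * n * √(stepSize γ₁ γ n) := by
  induction n, hn using Nat.le_induction with
  | base =>
    simp only [Finset.Icc_self, Finset.sum_singleton, Nat.cast_one]
    linarith [Real.sqrt_nonneg (stepSize γ₁ γ 1)]
  | succ n hn ih =>
    rw [Finset.sum_Icc_succ_top (by omega)]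
    have hn0 : (0 : ℝ) < n := by exact_mod_cast hn
    have h1 := stepSize_mul_le_succ hγ₁ hγ1 hn
    have hs := (stepSize_pos (γ := γ) hγ₁ hn).le
    have h2 : 2 * n * √(stepSize γ₁ γ n) ≤ (2 * n + 1) * √(stepSize γ₁ γ (n + 1)) := by
      have r : ∀ x : ℝ, 0 ≤ x → ∀ y, x * √y = √(x ^ 2 * y) := fun x hx y => by
        rw [Real.sqrt_mul (sq_nonneg _), Real.sqrt_sq hx]
      rw [r _ (by positivity), r _ (by positivity)]
      apply Real.sqrt_le_sqrt
      refine le_trans ?_ (mul_le_mul_of_nonneg_left h1 (sq_nonneg (2 * (n : ℝ) + 1)))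
      have h3 : (2 * (n : ℝ)) ^ 2 ≤ (2 * n + 1) ^ 2 * (n / (n + 1)) := by
        rw [← mul_div_assoc, le_div_iff₀ (by positivity)]
        nlinarith
      nlinarith [mul_le_mul_of_nonneg_left h3 hs]
    push_cast
    linarith

variable {S : Type*} [MeasurableSpace S] {P : Measure S}
  {Ω : Type*} [MeasurableSpace Ω] {μ : Measure Ω} [IsProbabilityMeasure μ]
  {Z : ℕ → Ω → S}

/-- This is nonnegativity of the variance of |f|. -/
lemma integral_abs_le_sqrt {f : Ω → ℝ} (hf : MemLp f 2 μ) :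
    ∫ ω, |f ω| ∂μ ≤ √(∫ ω, f ω ^ 2 ∂μ) := by
  refine Real.le_sqrt_of_sq_le ?_
  have h1 := variance_nonneg |f| μ
  rw [variance_eq_sub hf.abs] at h1
  simp only [Pi.pow_apply, Pi.abs_apply, sq_abs] at h1
  linarith

/-- Variances of independent terms add, so the average has variance of order 1/n; the L¹ norm is at
most the L² norm. -/
lemma integral_abs_average_sub_le (hZ : ∀ k, 1 ≤ k → Measurable (Z k))
    (hlaw : ∀ k, 1 ≤ k → μ.map (Z k) = P) (hind : iIndepFun (fun k : ℕ => Z (k + 1)) μ)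
    {a : S → ℝ} (ha : MemLp a 2 P) {n : ℕ} (hn : 1 ≤ n) :
    Integrable (fun ω => (1 / (n : ℝ)) * ∑ k ∈ Finset.Icc 1 n, a (Z k ω) - ∫ z, a z ∂P) μ ∧
    ∫ ω, |(1 / (n : ℝ)) * ∑ k ∈ Finset.Icc 1 n, a (Z k ω) - ∫ z, a z ∂P| ∂μ
      ≤ √(variance a P) / √n := by
  have hn0 : (0 : ℝ) < n := by exact_mod_cast hn
  have hP : IsProbabilityMeasure P := by
    rw [← hlaw 1 le_rfl]
    exact Measure.isProbabilityMeasure_map (hZ 1 le_rfl).aemeasurable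
  have hY : ∀ k, MemLp (fun ω => a (Z (k + 1) ω)) 2 μ := fun k => by
    rw [← hlaw (k + 1) (by omega)] at ha
    exact ha.comp_of_map (hZ (k + 1) (by omega)).aemeasurable
  have hYv : ∀ k, variance (fun ω => a (Z (k + 1) ω)) μ = variance a P := fun k => by
    rw [← hlaw (k + 1) (by omega)] at ha ⊢
    rw [variance_map ha.aestronglyMeasurable.aemeasurable (hZ (k + 1) (by omega)).aemeasurable]
    rfl
  have hYi : ∀ k, ∫ ω, a (Z (k + 1) ω) ∂μ = ∫ z, a z ∂P := fun k =>
    integral_comp_data hZ hlaw (by omega) (ha.integrable one_le_two)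
  set W : Ω → ℝ := ∑ k ∈ Finset.range n, fun ω => a (Z (k + 1) ω) with hW
  have hWm : MemLp W 2 μ := memLp_finsetSum' _ fun k _ => hY k
  have hWv : variance W μ = n * variance a P := by
    rw [hW, IndepFun.variance_sum (fun k _ => hY k)]
    · simp [hYv]
    · intro i _ j _ hij
      have h := hind.indepFun hij
      refine h.comp₀ (hZ _ (by omega)).aemeasurable (hZ _ (by omega)).aemeasurable ?_ ?_ <;>
      · rw [hlaw _ (by omega)]
        exact ha.aestronglyMeasurable.aemeasurable
  have hWi : ∫ ω, W ω ∂μ = n * ∫ z, a z ∂P := by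
    simp only [hW, Finset.sum_apply]
    rw [integral_finsetSum _ fun k _ => (hY k).integrable one_le_two]
    simp [hYi]
  have hform : (fun ω => (1 / (n : ℝ)) * ∑ k ∈ Finset.Icc 1 n, a (Z k ω) - ∫ z, a z ∂P)
      = fun ω => (1 / (n : ℝ)) * (W ω - ∫ ω, W ω ∂μ) := by
    ext ω
    rw [sum_Icc_one_eq_sum_range (fun k => a (Z k ω)), hWi]
    simp only [hW, Finset.sum_apply]
    field_simp
  have hWc : MemLp (fun ω => W ω - ∫ ω, W ω ∂μ) 2 μ := hWm.sub (memLp_const _)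
  rw [hform]
  refine ⟨(hWc.integrable one_le_two).const_mul _, ?_⟩
  have h1 := integral_abs_le_sqrt hWc
  rw [← variance_eq_integral hWm.aestronglyMeasurable.aemeasurable, hWv,
    Real.sqrt_mul hn0.le] at h1
  have h2 : (fun ω => |(1 / (n : ℝ)) * ∑ k ∈ Finset.Icc 1 n, a (Z k ω) - ∫ z, a z ∂P|)
      = fun ω => (1 / (n : ℝ)) * |W ω - ∫ ω, W ω ∂μ| := by
    ext ω
    rw [congrFun hform ω, abs_mul, abs_of_pos (by positivity : 0 < 1 / (n : ℝ))]
  rw [h2, integral_const_mul]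
  refine (mul_le_mul_of_nonneg_left h1 (by positivity)).trans (le_of_eq ?_)
  have h3 : √(n : ℝ) ≠ 0 := by positivity
  have h4 : (n : ℝ) = √n * √n := (Real.mul_self_sqrt hn0.le).symm
  rw [div_mul_eq_mul_div, one_mul, div_eq_div_iff hn0.ne' h3]
  nth_rewrite 3 [h4]
  ring

/-- Averages of perturbed samples: perturbations of size `O(γ_k^{1/2})` in mean keep the average
within `O(γ_n^{1/2})` of the expectation. -/
lemma exists_integral_abs_average_sub_le (hZ : ∀ k, 1 ≤ k → Measurable (Z k))
    (hlaw : ∀ k, 1 ≤ k → μ.map (Z k) = P) (hind : iIndepFun (fun k : ℕ => Z (k + 1)) μ)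
    {γ₁ γ : ℝ} (hγ₁ : 0 < γ₁) (hγ1 : γ ≤ 1) {a : S → ℝ} (ha : MemLp a 2 P)
    {X : ℕ → Ω → ℝ} {C : ℝ} (hC : 0 ≤ C)
    (hX : ∀ k, 1 ≤ k → Integrable (fun ω => X k ω - a (Z k ω)) μ ∧
      ∫ ω, |X k ω - a (Z k ω)| ∂μ ≤ C * √(stepSize γ₁ γ k)) :
    ∃ C' ≥ 0, ∀ n : ℕ, 1 ≤ n →
      Integrable (fun ω => (1 / (n : ℝ)) * ∑ k ∈ Finset.Icc 1 n, X k ω - ∫ z, a z ∂P) μ ∧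
      ∫ ω, |(1 / (n : ℝ)) * ∑ k ∈ Finset.Icc 1 n, X k ω - ∫ z, a z ∂P| ∂μ
        ≤ C' * √(stepSize γ₁ γ n) := by
  -- The first term comes from summing the perturbations, the second from rewriting n^{-1/2} in
  -- terms of the step size.
  refine ⟨2 * C + √(variance a P) / √γ₁, by positivity, fun n hn => ?_⟩
  have hn0 : (0 : ℝ) < n := by exact_mod_cast hn
  obtain ⟨h1, h2⟩ := integral_abs_average_sub_le hZ hlaw hind ha hn
  have hk : ∀ k ∈ Finset.Icc 1 n, 1 ≤ k := fun k hk => (Finset.mem_Icc.1 hk).1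
  have h3 : Integrable (fun ω => (1 / (n : ℝ)) * ∑ k ∈ Finset.Icc 1 n, (X k ω - a (Z k ω))) μ :=
    (integrable_finsetSum _ fun k hk' => (hX k (hk k hk')).1).const_mul _
  have hform : (fun ω => (1 / (n : ℝ)) * ∑ k ∈ Finset.Icc 1 n, X k ω - ∫ z, a z ∂P)
      = fun ω => (1 / (n : ℝ)) * ∑ k ∈ Finset.Icc 1 n, (X k ω - a (Z k ω))
        + ((1 / (n : ℝ)) * ∑ k ∈ Finset.Icc 1 n, a (Z k ω) - ∫ z, a z ∂P) := by
    ext ω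
    rw [Finset.sum_sub_distrib]
    ring
  have hi : Integrable
      (fun ω => (1 / (n : ℝ)) * ∑ k ∈ Finset.Icc 1 n, X k ω - ∫ z, a z ∂P) μ := by
    rw [hform]
    exact h3.add h1
  refine ⟨hi, ?_⟩
  have h4 : Integrable (fun ω => (1 / (n : ℝ)) * ∑ k ∈ Finset.Icc 1 n, |X k ω - a (Z k ω)|) μ :=
    (integrable_finsetSum _ fun k hk' => (hX k (hk k hk')).1.abs).const_mul _
  have h5 : ∫ ω, |(1 / (n : ℝ)) * ∑ k ∈ Finset.Icc 1 n, X k ω - ∫ z, a z ∂P| ∂μ ≤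
      ∫ ω, ((1 / (n : ℝ)) * ∑ k ∈ Finset.Icc 1 n, |X k ω - a (Z k ω)|
        + |(1 / (n : ℝ)) * ∑ k ∈ Finset.Icc 1 n, a (Z k ω) - ∫ z, a z ∂P|) ∂μ := by
    refine integral_mono hi.abs (h4.add h1.abs) fun ω => ?_
    rw [congrFun hform ω]
    refine (abs_add_le _ _).trans (add_le_add ?_ le_rfl)
    rw [abs_mul, abs_of_pos (by positivity : 0 < 1 / (n : ℝ))]
    gcongr
    exact Finset.abs_sum_le_sum_abs _ _
  rw [integral_add h4 h1.abs, integral_const_mul,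
    integral_finsetSum _ fun k hk' => (hX k (hk k hk')).1.abs] at h5
  have h6 : ∑ k ∈ Finset.Icc 1 n, ∫ ω, |X k ω - a (Z k ω)| ∂μ
      ≤ C * (2 * n * √(stepSize γ₁ γ n)) := by
    refine (Finset.sum_le_sum fun k hk' => (hX k (hk k hk')).2).trans ?_
    rw [← Finset.mul_sum]
    exact mul_le_mul_of_nonneg_left (sum_sqrt_stepSize_le hγ₁ hγ1 hn) hC
  have h7 : (1 / (n : ℝ)) * ∑ k ∈ Finset.Icc 1 n, ∫ ω, |X k ω - a (Z k ω)| ∂μ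
      ≤ 2 * C * √(stepSize γ₁ γ n) := by
    refine (mul_le_mul_of_nonneg_left h6 (by positivity)).trans (le_of_eq ?_)
    field_simp
  have h8 : √(variance a P) / √n ≤ √(variance a P) / √γ₁ * √(stepSize γ₁ γ n) := by
    have h9 := mul_le_mul_of_nonneg_left (sqrt_le_sqrt_stepSize hγ₁ hγ1 hn)
      (by positivity : 0 ≤ √(variance a P) / √γ₁)
    refine le_trans (le_of_eq ?_) h9
    have : √γ₁ ≠ 0 := by positivity
    field_simp
  rw [add_mul]
  linarith

end Averages

/-! ### From entries to the operator norm -/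

section Entrywise

variable {p : ℕ} {Ω : Type*} [MeasurableSpace Ω] {μ : Measure Ω}

/-- Entrywise mean bounds give a mean bound in the operator norm. -/
lemma integrable_norm_and_integral_norm_le {A : Ω → Matrix (Fin p) (Fin p) ℝ} {C : Fin p → Fin p → ℝ}
    {s : ℝ} (hA : ∀ i j, Integrable (fun ω => A ω i j) μ ∧ ∫ ω, |A ω i j| ∂μ ≤ C i j * s) :
    Integrable (fun ω => ‖A ω‖) μ ∧ ∫ ω, ‖A ω‖ ∂μ ≤ (∑ i, ∑ j, C i j) * s := by
  have hb : Integrable (fun ω => ∑ i, ∑ j, |A ω i j|) μ :=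
    integrable_finsetSum _ fun i _ => integrable_finsetSum _ fun j _ => (hA i j).1.abs
  have hi : Integrable (fun ω => ‖A ω‖) μ := by
    refine hb.mono' (aestronglyMeasurable_matrix fun i j => (hA i j).1.aestronglyMeasurable).norm
      (Eventually.of_forall fun ω => ?_)
    rw [norm_norm]
    exact l2_opNorm_le_sum_abs _
  refine ⟨hi, (integral_mono hi hb fun ω => l2_opNorm_le_sum_abs _).trans ?_⟩
  rw [integral_finsetSum _ fun i _ => integrable_finsetSum _ fun j _ => (hA i j).1.abs,
    Finset.sum_mul]
  refine Finset.sum_le_sum fun i _ => ?_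
  rw [integral_finsetSum _ fun j _ => (hA i j).1.abs, Finset.sum_mul]
  exact Finset.sum_le_sum fun j _ => (hA i j).2

end Entrywise

/-! ### Mean errors of the two averages, entry by entry -/

section Estimators

variable {p : ℕ} {S : Type*} [MeasurableSpace S] {P : Measure S}
  {ℓ : S → Param p → ℝ} {Ω : Type*} [MeasurableSpace Ω] {μ : Measure Ω} [IsProbabilityMeasure μ]
  {Z : ℕ → Ω → S} {θs : Param p} {β : S → ℝ} {σ M L₄ γ₁ γ K : ℝ} {θ : ℕ → Ω → Param p}

lemma integral_dist_le (hθm : ∀ n, Measurable (θ n))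
    (hD : ∀ n, Integrable (fun ω => ‖θ n ω - θs‖ ^ 2) μ ∧
      ∫ ω, ‖θ n ω - θs‖ ^ 2 ∂μ ≤ K * stepSize γ₁ γ (n + 1)) (hK : 0 ≤ K) (n : ℕ) :
    Integrable (fun ω => ‖θ n ω - θs‖) μ ∧
      ∫ ω, ‖θ n ω - θs‖ ∂μ ≤ √K * √(stepSize γ₁ γ (n + 1)) := by
  have h1 : MemLp (fun ω => ‖θ n ω - θs‖) 2 μ :=
    (memLp_two_iff_integrable_sq
      ((hθm n).sub_const θs).norm.aestronglyMeasurable).2 (hD n).1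
  refine ⟨h1.integrable one_le_two, ?_⟩
  have h2 := integral_abs_le_sqrt h1
  simp only [abs_norm] at h2
  rw [← Real.sqrt_mul hK]
  exact h2.trans (Real.sqrt_le_sqrt (hD n).2)

/-- Expanding the product of coordinates around `θs` leaves a term linear and a term quadratic in
the distance of the iterate. Their coefficients depend only on the new sample and are integrable, so
independence factors the means. -/
lemma exists_gradientCovAverage_apply_sub_le (hZ : ∀ k, 1 ≤ k → Measurable (Z k))
    (hlaw : ∀ k, 1 ≤ k → μ.map (Z k) = P) (hind : iIndepFun (fun k : ℕ => Z (k + 1)) μ)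
    (hconv : ConvexIntegrable P ℓ) (hsmooth : SmoothAround P ℓ θs β)
    (hnoise : NoiseLevel P ℓ θs σ) (hhess : HessianLipschitzAt P ℓ θs M)
    (hfour : Integrable (fun z => ‖gradient (ℓ z) θs‖ ^ 4) P)
    (hγ₁ : 0 < γ₁) (hγ0 : 0 ≤ γ) (hγ1 : γ ≤ 1)
    (hθm : ∀ n, Measurable[pastSigma Z n] (θ n))
    (hD : ∀ n, Integrable (fun ω => ‖θ n ω - θs‖ ^ 2) μ ∧
      ∫ ω, ‖θ n ω - θs‖ ^ 2 ∂μ ≤ K * stepSize γ₁ γ (n + 1)) (hK : 0 ≤ K) (i j : Fin p) :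
    ∃ C ≥ 0, ∀ n : ℕ, 1 ≤ n →
      Integrable (fun ω => (gradientCovAverage ℓ (fun k => Z k ω) (fun k => θ k ω) n
        - expectMat P (fun z => outer (gradient (ℓ z) θs))) i j) μ ∧
      ∫ ω, |(gradientCovAverage ℓ (fun k => Z k ω) (fun k => θ k ω) n
        - expectMat P (fun z => outer (gradient (ℓ z) θs))) i j| ∂μ
          ≤ C * √(stepSize γ₁ γ n) := by
  have hθm' : ∀ n, Measurable (θ n) := fun n => (hθm n).mono (pastSigma_le hZ n) le_rfl
  obtain ⟨G, H, hG, -, hGH⟩ := exists_measurable_gradient_hessian (fun θ => (hconv.2 θ).1)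
    (ae_differentiable hsmooth hhess)
  have hGi : ∀ i, Measurable fun q : S × Param p => G q.1 q.2 i := fun i =>
    (by fun_prop : Measurable fun x : Param p => x i).comp hG
  have hgL := memLp_gradient hconv hsmooth hnoise hhess θs
  have hga := fun i => (by fun_prop : Measurable fun x : Param p => x i).comp_aemeasurable
    (aemeasurable_gradient hconv hsmooth hhess θs)
  -- The fourth moment enters here: it puts the entries of the outer product in L², as the variance
  -- bound requires.
  have ha : MemLp (fun z => gradient (ℓ z) θs i * gradient (ℓ z) θs j) 2 P := by
    have hm : AEMeasurable (fun z => gradient (ℓ z) θs i * gradient (ℓ z) θs j) P :=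
      (hga i).mul (hga j)
    rw [memLp_two_iff_integrable_sq hm.aestronglyMeasurable]
    refine hfour.mono' (hm.pow_const 2).aestronglyMeasurable (Eventually.of_forall fun z => ?_)
    rw [norm_pow, norm_mul, show ‖gradient (ℓ z) θs‖ ^ 4
      = (‖gradient (ℓ z) θs‖ * ‖gradient (ℓ z) θs‖) ^ 2 by ring]
    gcongr <;> exact PiLp.norm_apply_le _ _
  have hβ2 : Integrable (fun z => β z ^ 2) P := hsmooth.1.integrable_sq
  have hβg : Integrable (fun z => 2 * (|β z| * ‖gradient (ℓ z) θs‖)) P :=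
    (hsmooth.1.abs.integrable_mul hgL.norm).const_mul 2
  set B₁ := ∫ z, β z ^ 2 ∂P with hB₁
  set B₂ := ∫ z, 2 * (|β z| * ‖gradient (ℓ z) θs‖) ∂P with hB₂
  have hB₁0 : 0 ≤ B₁ := integral_nonneg fun z => sq_nonneg _
  have hB₂0 : 0 ≤ B₂ := integral_nonneg fun z => by positivity
  have hX : ∀ k, 1 ≤ k → Integrable
      (fun ω => gradient (ℓ (Z k ω)) (θ (k - 1) ω) i * gradient (ℓ (Z k ω)) (θ (k - 1) ω) j
        - gradient (ℓ (Z k ω)) θs i * gradient (ℓ (Z k ω)) θs j) μ ∧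
      ∫ ω, |gradient (ℓ (Z k ω)) (θ (k - 1) ω) i * gradient (ℓ (Z k ω)) (θ (k - 1) ω) j
        - gradient (ℓ (Z k ω)) θs i * gradient (ℓ (Z k ω)) θs j| ∂μ
        ≤ (B₁ * K * √γ₁ + B₂ * √K) * √(stepSize γ₁ γ k) := by
    intro k hk
    -- The sample Z_k is paired with θ_{k-1}, whose mean squared error is O(γ_k), so the indices
    -- match.
    obtain ⟨k, rfl⟩ : ∃ m, k = m + 1 := ⟨k - 1, by omega⟩
    simp only [Nat.add_sub_cancel]
    obtain ⟨hd1, hd2⟩ := integral_dist_le hθm' hD hK k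
    obtain ⟨hi1, he1⟩ := integral_mul_of_past hZ hlaw hind (hθm k) hβ2
      (b := fun x : Param p => ‖x - θs‖ ^ 2) (by fun_prop) (hD k).1
    obtain ⟨hi2, he2⟩ := integral_mul_of_past hZ hlaw hind (hθm k) hβg
      (b := fun x : Param p => ‖x - θs‖) (by fun_prop) hd1
    have hpt : ∀ᵐ ω ∂μ, |gradient (ℓ (Z (k + 1) ω)) (θ k ω) i *
          gradient (ℓ (Z (k + 1) ω)) (θ k ω) j
        - gradient (ℓ (Z (k + 1) ω)) θs i * gradient (ℓ (Z (k + 1) ω)) θs j|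
        ≤ β (Z (k + 1) ω) ^ 2 * ‖θ k ω - θs‖ ^ 2
          + 2 * (|β (Z (k + 1) ω)| * ‖gradient (ℓ (Z (k + 1) ω)) θs‖) * ‖θ k ω - θs‖ := by
      filter_upwards [ae_comp_data hZ hlaw hk hsmooth.2] with ω hω
      have h1 := hω.2 (θ k ω)
      set g := gradient (ℓ (Z (k + 1) ω)) (θ k ω)
      set h := gradient (ℓ (Z (k + 1) ω)) θs
      have h2 : ‖g - h‖ ≤ |β (Z (k + 1) ω)| * ‖θ k ω - θs‖ := by
        refine h1.trans ?_
        gcongr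
        exact le_abs_self _
      have e1 : ∀ l, |(g - h) l| ≤ ‖g - h‖ := fun l => PiLp.norm_apply_le (g - h) l
      have e2 : ∀ l, |h l| ≤ ‖h‖ := fun l => PiLp.norm_apply_le h l
      have e3 : g i * g j - h i * h j
          = (g - h) i * (g - h) j + (g - h) i * h j + h i * (g - h) j := by
        simp only [PiLp.sub_apply]; ring
      have e4 : |g i * g j - h i * h j| ≤ ‖g - h‖ * ‖g - h‖ + ‖g - h‖ * ‖h‖ + ‖h‖ * ‖g - h‖ := by
        rw [e3]
        refine (abs_add_three _ _ _).trans ?_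
        simp only [abs_mul]
        gcongr
        exacts [e1 i, e1 j, e1 i, e2 j, e2 i, e1 j]
      set d := |β (Z (k + 1) ω)| * ‖θ k ω - θs‖
      have e5 : ‖g - h‖ * ‖g - h‖ + ‖g - h‖ * ‖h‖ + ‖h‖ * ‖g - h‖ ≤ d * d + d * ‖h‖ + ‖h‖ * d := by
        gcongr
      refine (e4.trans e5).trans (le_of_eq ?_)
      rw [← sq_abs (β (Z (k + 1) ω))]
      simp only [d]
      ring
    have hm : AEStronglyMeasurable (fun ω => gradient (ℓ (Z (k + 1) ω)) (θ k ω) i *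
          gradient (ℓ (Z (k + 1) ω)) (θ k ω) j
        - gradient (ℓ (Z (k + 1) ω)) θs i * gradient (ℓ (Z (k + 1) ω)) θs j) μ := by
      have hq := (hZ _ hk).prodMk (hθm' k)
      have hqs : Measurable fun ω => (Z (k + 1) ω, θs) := (hZ _ hk).prodMk measurable_const
      refine ((((hGi i).comp hq).mul ((hGi j).comp hq)).sub
        (((hGi i).comp hqs).mul ((hGi j).comp hqs))).aestronglyMeasurable.congr ?_
      filter_upwards [ae_comp_data hZ hlaw hk hGH] with ω hω
      simp [hω.1]
    have hi := (hi1.add hi2).mono' hm hpt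
    refine ⟨hi, (integral_mono_ae hi.abs (hi1.add hi2) hpt).trans ?_⟩
    rw [integral_add' hi1 hi2, he1, he2, ← hB₁, ← hB₂]
    set s := stepSize γ₁ γ (k + 1) with hs
    have hs0 : 0 < s := stepSize_pos hγ₁ hk
    -- The quadratic term is O(γ_k); bounded steps turn this into O(γ_k^{1/2}).
    have h5 : s ≤ √γ₁ * √s := by
      have h6 : √s ≤ √γ₁ := Real.sqrt_le_sqrt (stepSize_le hγ₁ hγ0 hk)
      calc s = √s * √s := (Real.mul_self_sqrt hs0.le).symm
        _ ≤ √γ₁ * √s := by gcongr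
    calc B₁ * ∫ ω, ‖θ k ω - θs‖ ^ 2 ∂μ + B₂ * ∫ ω, ‖θ k ω - θs‖ ∂μ
        ≤ B₁ * (K * (√γ₁ * √s)) + B₂ * (√K * √s) := by
          gcongr
          exact (hD k).2.trans (by gcongr)
      _ = _ := by ring
  obtain ⟨C, hC, h⟩ := exists_integral_abs_average_sub_le hZ hlaw hind hγ₁ hγ1 ha
    (X := fun k ω => gradient (ℓ (Z k ω)) (θ (k - 1) ω) i *
      gradient (ℓ (Z k ω)) (θ (k - 1) ω) j) (by positivity) hX
  refine ⟨C, hC, fun n hn => ?_⟩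
  have hform : ∀ ω, (gradientCovAverage ℓ (fun k => Z k ω) (fun k => θ k ω) n
        - expectMat P (fun z => outer (gradient (ℓ z) θs))) i j
      = (1 / (n : ℝ)) * ∑ k ∈ Finset.Icc 1 n, gradient (ℓ (Z k ω)) (θ (k - 1) ω) i *
          gradient (ℓ (Z k ω)) (θ (k - 1) ω) j
        - ∫ z, gradient (ℓ z) θs i * gradient (ℓ z) θs j ∂P := by
    intro ω
    simp [gradientCovAverage, expectMat, outer, Matrix.sum_apply]
  simp only [hform]
  exact h n hn

variable [IsProbabilityMeasure P]

/-- The perturbation is at most |M| times the distance of the iterate, almost surely; the entries at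
`θs` are in L² with mean the Hessian of the objective. -/
lemma exists_hessianAverage_apply_sub_le (hZ : ∀ k, 1 ≤ k → Measurable (Z k))
    (hlaw : ∀ k, 1 ≤ k → μ.map (Z k) = P) (hind : iIndepFun (fun k : ℕ => Z (k + 1)) μ)
    (hconv : ConvexIntegrable P ℓ) (hsmooth : SmoothAround P ℓ θs β)
    (hnoise : NoiseLevel P ℓ θs σ) (hhess : HessianLipschitzAt P ℓ θs M)
    (hhess2 : HessianSecondMoment P ℓ θs L₄) (hγ₁ : 0 < γ₁) (hγ1 : γ ≤ 1)
    (hθm : ∀ n, Measurable[pastSigma Z n] (θ n))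
    (hD : ∀ n, Integrable (fun ω => ‖θ n ω - θs‖ ^ 2) μ ∧
      ∫ ω, ‖θ n ω - θs‖ ^ 2 ∂μ ≤ K * stepSize γ₁ γ (n + 1)) (hK : 0 ≤ K) (i j : Fin p) :
    ∃ C ≥ 0, ∀ n : ℕ, 1 ≤ n →
      Integrable (fun ω => (hessianAverage ℓ (fun k => Z k ω) (fun k => θ k ω) n
        - hessian (objective P ℓ) θs) i j) μ ∧
      ∫ ω, |(hessianAverage ℓ (fun k => Z k ω) (fun k => θ k ω) n
        - hessian (objective P ℓ) θs) i j| ∂μ ≤ C * √(stepSize γ₁ γ n) := by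
  have hθm' : ∀ n, Measurable (θ n) := fun n => (hθm n).mono (pastSigma_le hZ n) le_rfl
  obtain ⟨G, H, -, hH, hGH⟩ := exists_measurable_gradient_hessian (fun θ => (hconv.2 θ).1)
    (ae_differentiable hsmooth hhess)
  have ha := memLp_hessian_apply hconv hsmooth hhess hhess2 i j
  have hX : ∀ k, 1 ≤ k → Integrable
      (fun ω => hessian (ℓ (Z k ω)) (θ (k - 1) ω) i j - hessian (ℓ (Z k ω)) θs i j) μ ∧
      ∫ ω, |hessian (ℓ (Z k ω)) (θ (k - 1) ω) i j - hessian (ℓ (Z k ω)) θs i j| ∂μ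
        ≤ |M| * √K * √(stepSize γ₁ γ k) := by
    intro k hk
    obtain ⟨k, rfl⟩ : ∃ m, k = m + 1 := ⟨k - 1, by omega⟩
    simp only [Nat.add_sub_cancel]
    obtain ⟨hd1, hd2⟩ := integral_dist_le hθm' hD hK k
    have hpt : ∀ᵐ ω ∂μ, |hessian (ℓ (Z (k + 1) ω)) (θ k ω) i j - hessian (ℓ (Z (k + 1) ω)) θs i j|
        ≤ |M| * ‖θ k ω - θs‖ := by
      filter_upwards [ae_comp_data hZ hlaw hk hhess] with ω hω
      have h1 := abs_apply_le_l2_opNorm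
        (hessian (ℓ (Z (k + 1) ω)) (θ k ω) - hessian (ℓ (Z (k + 1) ω)) θs) i j
      refine (h1.trans (hω _).2).trans ?_
      gcongr
      exact le_abs_self M
    have hm : AEStronglyMeasurable (fun ω =>
        hessian (ℓ (Z (k + 1) ω)) (θ k ω) i j - hessian (ℓ (Z (k + 1) ω)) θs i j) μ := by
      have hqs : Measurable fun ω => (Z (k + 1) ω, θs) := (hZ _ hk).prodMk measurable_const
      refine (((hH i j).comp ((hZ _ hk).prodMk (hθm' k))).sub
        ((hH i j).comp hqs)).aestronglyMeasurable.congr ?_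
      filter_upwards [ae_comp_data hZ hlaw hk hGH] with ω hω
      simp [hω.2]
    have hi := (hd1.const_mul |M|).mono' hm hpt
    refine ⟨hi, (integral_mono_ae hi.abs (hd1.const_mul |M|) hpt).trans ?_⟩
    rw [integral_const_mul, mul_assoc]
    gcongr
  obtain ⟨C, hC, h⟩ := exists_integral_abs_average_sub_le hZ hlaw hind hγ₁ hγ1 ha
    (X := fun k ω => hessian (ℓ (Z k ω)) (θ (k - 1) ω) i j) (by positivity) hX
  refine ⟨C, hC, fun n hn => ?_⟩
  have hform : ∀ ω, (hessianAverage ℓ (fun k => Z k ω) (fun k => θ k ω) n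
        - hessian (objective P ℓ) θs) i j
      = (1 / (n : ℝ)) * ∑ k ∈ Finset.Icc 1 n, hessian (ℓ (Z k ω)) (θ (k - 1) ω) i j
        - ∫ z, hessian (ℓ z) θs i j ∂P := by
    intro ω
    rw [Matrix.sub_apply, hessian_objective_apply hconv hsmooth hnoise hhess hhess2]
    simp [hessianAverage, Matrix.sum_apply]
  simp only [hform]
  exact h n hn

end Estimators

/-! ### Stability and measurability of the eigenvalue floor -/

section Floor

variable {p : ℕ} {δ : ℝ} {A H : Matrix (Fin p) (Fin p) ℝ}

lemma lt_of_mem_spectrum (hH : H.IsHermitian) (hδ : δ < lambdaMin H) {x : ℝ}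
    (hx : x ∈ spectrum ℝ H) : δ < x := by
  refine hδ.trans_le (csInf_le ?_ hx)
  rw [hH.spectrum_real_eq_range_eigenvalues]
  exact (Set.finite_range _).bddBelow

lemma isUnit_of_lambdaMin (hH : H.IsHermitian) (hδ : δ ∈ Set.Ioo 0 (lambdaMin H)) : IsUnit H := by
  rw [← spectrum.zero_notMem_iff ℝ]
  intro h0
  have := lt_of_mem_spectrum hH hδ.2 h0
  linarith [hδ.1]

/-- Subtracting δ shifts the spectrum into the nonnegative reals, so `H` minus δ times the identity
is positive semidefinite. -/
lemma mul_sq_norm_le_quadForm (hH : H.IsHermitian) (hδ : δ < lambdaMin H) (x : Param p) :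
    δ * ‖x‖ ^ 2 ≤ x.ofLp ⬝ᵥ H *ᵥ x.ofLp := by
  have h1 : (H - algebraMap ℝ _ δ).PosSemidef := by
    rw [Matrix.posSemidef_iff_isHermitian_and_spectrum_nonneg]
    refine ⟨hH.sub (IsSelfAdjoint.algebraMap _ (IsSelfAdjoint.all δ)), ?_⟩
    rw [← spectrum.sub_singleton_eq]
    rintro _ ⟨y, hy, _, rfl, rfl⟩
    exact sub_nonneg.2 (lt_of_mem_spectrum hH hδ hy).le
  have h2 : 0 ≤ x.ofLp ⬝ᵥ (H - algebraMap ℝ _ δ) *ᵥ x.ofLp := by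
    simpa using h1.dotProduct_mulVec_nonneg x.ofLp
  have h3 : x.ofLp ⬝ᵥ x.ofLp = ‖x‖ ^ 2 := by
    rw [EuclideanSpace.real_norm_sq_eq]
    simp [dotProduct, sq]
  rw [Algebra.algebraMap_eq_smul_one, Matrix.sub_mulVec, Matrix.smul_mulVec, Matrix.one_mulVec,
    dotProduct_sub, dotProduct_smul, h3, smul_eq_mul] at h2
  linarith

/-- A Weyl-type bound: at a unit eigenvector of `A`, the form of `H` is at least δ and that of `H -
A` at most ‖A - H‖. -/
lemma sub_norm_le_of_mem_spectrum (hA : A.IsHermitian) (hH : H.IsHermitian)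
    (hδ : δ < lambdaMin H) {x : ℝ} (hx : x ∈ spectrum ℝ A) : δ - ‖A - H‖ ≤ x := by
  rw [hA.spectrum_real_eq_range_eigenvalues] at hx
  obtain ⟨i, rfl⟩ := hx
  set v := hA.eigenvectorBasis i
  have hv : ‖v‖ = 1 := hA.eigenvectorBasis.orthonormal.1 i
  have h1 := mul_sq_norm_le_quadForm hH hδ v
  have h2 := quadForm_le (H - A) v
  have h3 : v.ofLp ⬝ᵥ v.ofLp = ‖v‖ ^ 2 := by
    rw [EuclideanSpace.real_norm_sq_eq]
    simp [dotProduct, sq]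
  rw [Matrix.sub_mulVec, dotProduct_sub, hA.mulVec_eigenvectorBasis i, dotProduct_smul, h3, hv,
    norm_sub_rev] at h2
  rw [hv] at h1
  simp only [smul_eq_mul] at h2
  linarith

/-- Writing the inverse in the functional calculus of a continuous function bounded by δ⁻¹ yields
both its norm bound and its measurability. -/
lemma eigenvalueFloor_inv (hδ : 0 < δ) (hA : A.IsHermitian) :
    eigenvalueFloor δ A * cfc (fun x : ℝ => (max x δ)⁻¹) A = 1 ∧
      (eigenvalueFloor δ A)⁻¹ = cfc (fun x : ℝ => (max x δ)⁻¹) A := by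
  have hpos : ∀ x : ℝ, max x δ ≠ 0 := fun x => (lt_of_lt_of_le hδ (le_max_right x δ)).ne'
  have hc : Continuous fun x : ℝ => max x δ := by fun_prop
  have hci : Continuous fun x : ℝ => (max x δ)⁻¹ := hc.inv₀ hpos
  have h : eigenvalueFloor δ A * cfc (fun x : ℝ => (max x δ)⁻¹) A = 1 := by
    rw [eigenvalueFloor_eq_cfc, ← cfc_mul _ _ A hc.continuousOn hci.continuousOn]
    simp only [mul_inv_cancel₀ (hpos _)]
    exact cfc_const_one ℝ A hA
  exact ⟨h, Matrix.inv_eq_right_inv h⟩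

lemma norm_eigenvalueFloor_inv_le (hδ : 0 < δ) (hA : A.IsHermitian) :
    ‖(eigenvalueFloor δ A)⁻¹‖ ≤ δ⁻¹ := by
  rw [(eigenvalueFloor_inv hδ hA).2]
  refine norm_cfc_le (by positivity) fun x _ => ?_
  have h : δ ≤ max x δ := le_max_right x δ
  rw [Real.norm_of_nonneg (inv_nonneg.2 (hδ.le.trans h))]
  gcongr

/-- Flooring raises an eigenvalue only up to δ, and none of `A` lies below δ - ‖A - H‖, so the floor
moves `A` by at most ‖A - H‖. The triangle inequality finishes. -/
lemma norm_eigenvalueFloor_sub_le (hA : A.IsHermitian) (hH : H.IsHermitian)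
    (hδ : δ < lambdaMin H) : ‖eigenvalueFloor δ A - H‖ ≤ 2 * ‖A - H‖ := by
  have hc : Continuous fun x : ℝ => max x δ := by fun_prop
  have h1 : eigenvalueFloor δ A - A = cfc (fun x : ℝ => max x δ - x) A := by
    rw [eigenvalueFloor_eq_cfc, cfc_sub (fun x : ℝ => max x δ) (fun x => x) A hc.continuousOn
      continuousOn_id, cfc_id' ℝ A (show IsSelfAdjoint A from hA)]
  have h2 : ‖eigenvalueFloor δ A - A‖ ≤ ‖A - H‖ := by
    rw [h1]
    refine norm_cfc_le (norm_nonneg _) fun x hx => ?_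
    have h3 := sub_norm_le_of_mem_spectrum hA hH hδ hx
    rw [Real.norm_of_nonneg (sub_nonneg.2 (le_max_left x δ)), sub_le_iff_le_add]
    exact max_le (by linarith [norm_nonneg (A - H)]) (by linarith)
  have h3 := norm_sub_le_norm_sub_add_norm_sub (eigenvalueFloor δ A) A H
  linarith

/-- Deterministic stability of the sandwich estimator. -/
lemma norm_sandwich_sub_le (hA : A.IsHermitian) (hH : H.IsHermitian)
    (hδ : δ ∈ Set.Ioo 0 (lambdaMin H)) (B I : Matrix (Fin p) (Fin p) ℝ) :
    ‖(eigenvalueFloor δ A)⁻¹ * B * (eigenvalueFloor δ A)⁻¹ - H⁻¹ * I * H⁻¹‖ ≤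
      δ⁻¹ ^ 2 * ‖B - I‖ + (δ⁻¹ + ‖H⁻¹‖) * ‖I‖ * (δ⁻¹ * ‖H⁻¹‖ * 2) * ‖A - H‖ := by
  have hdet := (Matrix.isUnit_iff_isUnit_det H).1 (isUnit_of_lambdaMin hH hδ)
  obtain ⟨hinv, heq⟩ := eigenvalueFloor_inv hδ.1 hA
  rw [← heq] at hinv
  have hG := norm_eigenvalueFloor_inv_le hδ.1 hA
  have hF := norm_eigenvalueFloor_sub_le hA hH hδ.2
  set F := eigenvalueFloor δ A
  set G := F⁻¹
  have hinv' : G * F = 1 := mul_eq_one_comm.1 hinv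
  have hδ0 : 0 ≤ δ⁻¹ := inv_nonneg.2 hδ.1.le
  have e1 : G - H⁻¹ = G * (H - F) * H⁻¹ := by
    rw [mul_sub, sub_mul, hinv', mul_assoc, Matrix.mul_nonsing_inv H hdet]
    simp
  have h1 : ‖G - H⁻¹‖ ≤ δ⁻¹ * ‖H⁻¹‖ * 2 * ‖A - H‖ := by
    rw [e1]
    calc ‖G * (H - F) * H⁻¹‖ ≤ ‖G‖ * ‖H - F‖ * ‖H⁻¹‖ :=
          (norm_mul_le _ _).trans (by gcongr; exact norm_mul_le _ _)
      _ ≤ δ⁻¹ * (2 * ‖A - H‖) * ‖H⁻¹‖ := by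
          rw [norm_sub_rev H F]
          gcongr
      _ = _ := by ring
  -- The telescoping keeps `B` only in `B - I`, between factors bounded by δ⁻¹, so no product of the
  -- two estimation errors arises.
  have e2 : G * B * G - H⁻¹ * I * H⁻¹
      = G * (B - I) * G + (G - H⁻¹) * I * G + H⁻¹ * I * (G - H⁻¹) := by
    noncomm_ring
  have n3 : ∀ X Y W : Matrix (Fin p) (Fin p) ℝ, ‖X * Y * W‖ ≤ ‖X‖ * ‖Y‖ * ‖W‖ := fun X Y W =>
    (norm_mul_le _ _).trans (by gcongr; exact norm_mul_le _ _)
  rw [e2]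
  calc ‖G * (B - I) * G + (G - H⁻¹) * I * G + H⁻¹ * I * (G - H⁻¹)‖
      ≤ ‖G‖ * ‖B - I‖ * ‖G‖ + ‖G - H⁻¹‖ * ‖I‖ * ‖G‖ + ‖H⁻¹‖ * ‖I‖ * ‖G - H⁻¹‖ :=
        norm_add₃_le.trans (by gcongr <;> exact n3 _ _ _)
    _ ≤ δ⁻¹ * ‖B - I‖ * δ⁻¹ + (δ⁻¹ * ‖H⁻¹‖ * 2 * ‖A - H‖) * ‖I‖ * δ⁻¹
        + ‖H⁻¹‖ * ‖I‖ * (δ⁻¹ * ‖H⁻¹‖ * 2 * ‖A - H‖) := by gcongr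
    _ = _ := by ring

/-- The functional calculus is continuous on self-adjoint matrices; symmetrizing first gives a
continuous map on all matrices that agrees with it on symmetric ones. Measurability of the floored
inverse follows. -/
lemma continuous_cfc_symmetrize {f : ℝ → ℝ} (hf : Continuous f) :
    Continuous fun A : Matrix (Fin p) (Fin p) ℝ => cfc f ((1 / 2 : ℝ) • (A + star A)) := by
  refine Continuous.cfc_of_mem_nhdsSet (s := Set.univ) f univ_mem (by fun_prop) (fun A => ?_)
    hf.continuousOn
  exact (IsSelfAdjoint.all (1 / 2 : ℝ)).smul (IsSelfAdjoint.add_star_self A)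

lemma aestronglyMeasurable_eigenvalueFloor_inv (hδ : 0 < δ) {Ω : Type*} [MeasurableSpace Ω]
    {μ : Measure Ω} {X : Ω → Matrix (Fin p) (Fin p) ℝ} (hX : AEStronglyMeasurable X μ)
    (hsymm : ∀ᵐ ω ∂μ, (X ω).IsHermitian) :
    AEStronglyMeasurable (fun ω => (eigenvalueFloor δ (X ω))⁻¹) μ := by
  have hc : Continuous fun x : ℝ => (max x δ)⁻¹ :=
    (by fun_prop : Continuous fun x : ℝ => max x δ).inv₀
      fun x => (lt_of_lt_of_le hδ (le_max_right x δ)).ne'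
  refine ((continuous_cfc_symmetrize hc).comp_aestronglyMeasurable hX).congr ?_
  filter_upwards [hsymm] with ω hω
  rw [(eigenvalueFloor_inv hδ hω).2]
  congr 1
  have : star (X ω) = X ω := hω
  rw [this, ← two_smul ℝ (X ω), smul_smul]
  norm_num

end Floor

end ProxRM

/-! ### The plug-in estimator -/

theorem mainTheorem5 {p : ℕ}
    -- the data space with the data distribution, and the sample function
    {S : Type*} [MeasurableSpace S] (P : Measure S) [IsProbabilityMeasure P]
    (ℓ : S → Param p → ℝ)
    -- independent samples `Z 1, Z 2, …` from `P`
    {Ω : Type*} [MeasurableSpace Ω] (μ : Measure Ω) [IsProbabilityMeasure μ]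
    (Z : ℕ → Ω → S)
    (hZ_meas : ∀ k, 1 ≤ k → Measurable (Z k))
    (hZ_law : ∀ k, 1 ≤ k → μ.map (Z k) = P)
    (hZ_indep : iIndepFun (fun k : ℕ => Z (k + 1)) μ)
    -- the minimizer of the objective
    (θs : Param p) (hθs : IsMinOn (objective P ℓ) Set.univ θs)
    -- the learning rate and the iterates
    (γ₁ γ : ℝ) (hγ₁ : 0 < γ₁) (hγ : γ ∈ Set.Ioo (1 / 2 : ℝ) 1)
    (θ₀ : Param p) (θ : ℕ → Ω → Param p)
    (hθ : ∀ n ω, θ n ω = iterate ℓ (stepSize γ₁ γ) θ₀ (fun k => Z k ω) n)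
    -- the assumptions on the problem
    (β : S → ℝ) (Λ : S → Matrix (Fin p) (Fin p) ℝ) (σ Sig₃ Sig₄ M L₄ : ℝ)
    (hconv : ConvexIntegrable P ℓ)
    (hsmooth : SmoothAround P ℓ θs β)
    (hstrong : StronglyConvexInMean P ℓ θs Λ)
    (hnoise : NoiseLevel P ℓ θs σ)
    (htwice : TwiceDifferentiableAt (objective P ℓ) θs)
    (hfourth : FourthMomentBound μ P ℓ Z θ θs Sig₃ Sig₄)
    (hhess : HessianLipschitzAt P ℓ θs M)
    (hhess2 : HessianSecondMoment P ℓ θs L₄)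
    -- the floor for the eigenvalues
    (δ : ℝ) (hδ : δ ∈ Set.Ioo 0 (lambdaMin (hessian (objective P ℓ) θs)))
    -- the estimators and the matrices they estimate
    (Ht Ih : ℕ → Ω → Matrix (Fin p) (Fin p) ℝ)
    (hHt : ∀ n ω, Ht n ω =
      eigenvalueFloor δ (hessianAverage ℓ (fun k => Z k ω) (fun k => θ k ω) n))
    (hIh : ∀ n ω, Ih n ω = gradientCovAverage ℓ (fun k => Z k ω) (fun k => θ k ω) n)
    (H I : Matrix (Fin p) (Fin p) ℝ)
    (hH : H = hessian (objective P ℓ) θs)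
    (hI : I = expectMat P (fun z => outer (gradient (ℓ z) θs))) :
    ∃ c : ℝ, 0 < c ∧ ∀ n : ℕ, 1 ≤ n →
      Integrable (fun ω => ‖(Ht n ω)⁻¹ * Ih n ω * (Ht n ω)⁻¹ - H⁻¹ * I * H⁻¹‖) μ ∧
      ∫ ω, ‖(Ht n ω)⁻¹ * Ih n ω * (Ht n ω)⁻¹ - H⁻¹ * I * H⁻¹‖ ∂μ ≤
        c * stepSize γ₁ γ n ^ (1 / 2 : ℝ) := by
  have hγ0 : 0 < γ := by linarith [hγ.1]
  have hθeq : θ = fun n ω => iterate ℓ (stepSize γ₁ γ) θ₀ (fun k => Z k ω) n := by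
    ext1 n; ext1 ω; exact hθ n ω
  have hθm : ∀ n, Measurable[pastSigma Z n] (θ n) := by
    rw [hθeq]
    exact measurable_iterate hconv.1 (fun θ => (hconv.2 θ).1)
      (fun n hn => stepSize_pos hγ₁ hn) θ₀ Z
  obtain ⟨K, hK, hD⟩ := exists_sq_dist_iterate_le hZ_meas hZ_law hZ_indep hθs hconv hsmooth
    hstrong hnoise hhess hγ₁ hγ0 hγ.2 θ₀
  replace hD : ∀ n, Integrable (fun ω => ‖θ n ω - θs‖ ^ 2) μ ∧
      ∫ ω, ‖θ n ω - θs‖ ^ 2 ∂μ ≤ K * stepSize γ₁ γ (n + 1) := by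
    rw [hθeq]
    exact hD
  have hlim : Tendsto (fun n => ∫ ω, ‖θ n ω - θs‖ ^ 2 ∂μ) atTop (𝓝 0) := by
    refine squeeze_zero (fun n => integral_nonneg fun ω => sq_nonneg _) (fun n => (hD n).2) ?_
    simpa using (((tendsto_stepSize (γ₁ := γ₁) hγ0).comp (tendsto_add_atTop_nat 1)).const_mul K)
  have hfour := integrable_norm_gradient_pow_four hZ_meas hZ_law hZ_indep hθs hconv hsmooth htwice
    hhess hfourth hθm (fun n => (hD n).1) hlim
  choose C₁ hC₁ hHi using fun i j => exists_hessianAverage_apply_sub_le hZ_meas hZ_law hZ_indep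
    hconv hsmooth hnoise hhess hhess2 hγ₁ hγ.2.le hθm hD hK.le i j
  choose C₂ hC₂ hIi using fun i j => exists_gradientCovAverage_apply_sub_le hZ_meas hZ_law hZ_indep
    hconv hsmooth hnoise hhess hfour hγ₁ hγ0.le hγ.2.le hθm hD hK.le i j
  have hHs := isSymm_hessian htwice
  rw [← hH] at hδ hHs
  simp only [← hH] at hHi
  simp only [← hI, ← hIh] at hIi
  set D₁ := ∑ i, ∑ j, C₁ i j
  set D₂ := ∑ i, ∑ j, C₂ i j
  have hD₁ : 0 ≤ D₁ := Finset.sum_nonneg fun i _ => Finset.sum_nonneg fun j _ => hC₁ i j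
  have hD₂ : 0 ≤ D₂ := Finset.sum_nonneg fun i _ => Finset.sum_nonneg fun j _ => hC₂ i j
  set a := δ⁻¹ ^ 2
  set b := (δ⁻¹ + ‖H⁻¹‖) * ‖I‖ * (δ⁻¹ * ‖H⁻¹‖ * 2)
  have ha : 0 ≤ a := sq_nonneg _
  have hδ0 : 0 ≤ δ⁻¹ := inv_nonneg.2 hδ.1.le
  have hb : 0 ≤ b := by positivity
  -- The constants of the two mean bounds, weighted as in the sandwich estimate; the added 1
  -- guarantees positivity.
  refine ⟨a * D₂ + b * D₁ + 1, by positivity, fun n hn => ?_⟩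
  set A : Ω → Matrix (Fin p) (Fin p) ℝ :=
    fun ω => hessianAverage ℓ (fun k => Z k ω) (fun k => θ k ω) n with hA
  obtain ⟨hA1, hA2⟩ := integrable_norm_and_integral_norm_le (A := fun ω => A ω - H)
    fun i j => hHi i j n hn
  obtain ⟨hB1, hB2⟩ := integrable_norm_and_integral_norm_le (A := fun ω => Ih n ω - I)
    fun i j => hIi i j n hn
  -- The floor takes the default value 0 off symmetric matrices, so almost sure symmetry must
  -- precede the stability bound.
  have hsymm : ∀ᵐ ω ∂μ, (A ω).IsHermitian := by
    have h1 : ∀ k ∈ Finset.Icc 1 n, ∀ᵐ ω ∂μ, (hessian (ℓ (Z k ω)) (θ (k - 1) ω)).IsHermitian := by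
      intro k hk
      filter_upwards [ae_comp_data hZ_meas hZ_law (Finset.mem_Icc.1 hk).1 hhess] with ω hω
      exact isSymm_hessian (hω _).1
    filter_upwards [(Finset.eventually_all _).2 h1] with ω hω
    exact IsSelfAdjoint.smul (IsSelfAdjoint.all _) (isSelfAdjoint_sum _ hω)
  have hAm : AEStronglyMeasurable A μ := by
    have h1 : AEStronglyMeasurable (fun ω => A ω - H) μ :=
      aestronglyMeasurable_matrix fun i j => (hHi i j n hn).1.aestronglyMeasurable
    simpa using h1.add_const H
  have hBm : AEStronglyMeasurable (Ih n) μ := by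
    have h1 : AEStronglyMeasurable (fun ω => Ih n ω - I) μ :=
      aestronglyMeasurable_matrix fun i j => (hIi i j n hn).1.aestronglyMeasurable
    simpa using h1.add_const I
  have hGm := aestronglyMeasurable_eigenvalueFloor_inv hδ.1 hAm hsymm
  have hbound : Integrable (fun ω => a * ‖Ih n ω - I‖ + b * ‖A ω - H‖) μ :=
    (hB1.const_mul a).add (hA1.const_mul b)
  have hle : ∀ᵐ ω ∂μ, ‖(Ht n ω)⁻¹ * Ih n ω * (Ht n ω)⁻¹ - H⁻¹ * I * H⁻¹‖
      ≤ a * ‖Ih n ω - I‖ + b * ‖A ω - H‖ := by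
    filter_upwards [hsymm] with ω hω
    rw [hHt]
    exact norm_sandwich_sub_le hω hHs hδ (Ih n ω) I
  have hi : Integrable (fun ω => ‖(Ht n ω)⁻¹ * Ih n ω * (Ht n ω)⁻¹ - H⁻¹ * I * H⁻¹‖) μ := by
    refine hbound.mono' ?_ (hle.mono fun ω hω => by rwa [norm_norm])
    simp only [hHt]
    exact (((hGm.mul hBm).mul hGm).sub aestronglyMeasurable_const).norm
  refine ⟨hi, (integral_mono_ae hi hbound hle).trans ?_⟩
  rw [integral_add (hB1.const_mul a) (hA1.const_mul b), integral_const_mul, integral_const_mul,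
    ← Real.sqrt_eq_rpow]
  have h1 := mul_le_mul_of_nonneg_left hA2 hb
  have h2 := mul_le_mul_of_nonneg_left hB2 ha
  have h3 := Real.sqrt_nonneg (stepSize γ₁ γ n)
  linarith
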